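/- Let $r\ge 3$, let $F_r$ be the free group with free basis $A=\{a_1,\dots,a_r\}$, and let $S$ be the finite set of all standard Nielsen automorphisms $\theta=[x\mapsto yx]$, where $x,y\in A^{\pm1}$, $y\ne x^{\pm1}$: $\theta(x)=yx$ and $\theta(z)=z$ for $z\in A^{\pm1}\setminus\{x,x^{-1}\}$. An ordered pair $([x\mapsto yx],[x'\mapsto y'x'])$ is *admissible* if either $x'=x$ and $y'\ne y^{-1}$, or $y'=x$ and $x'\ne y^{-1}$. A sequence $\theta_1,\dots,\theta_n$ in $S$ ($n\ge1$) is *cyclically admissible* if all pairs $(\theta_i,\theta_{i+1})$, $1\le i<n$, and the pair $(\theta_n,\theta_1)$ are admissible. Let $\mu_{\mathcal W}$ be the law on $S^{\mathbb N}$ of the Markov chain whose initial distribution is uniform on $S$ and whose transition probability from $\theta$ to $\theta'$ is $1/(4r-6)$ if $(\theta,\theta')$ is admissible and $0$ otherwise. Let $R_r$ be the rose with one vertex and edges $e_1,\dots,e_r$, with $\pi_1(R_r)$ identified with $F_r$ by $e_i\leftrightarrow a_i$. For $\theta\in S$ let $g_\theta:R_r\to R_r$ be the graph map sending $e_i$ to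 the edge-path spelling the reduced word $\theta(a_i)$. For a sequence $\mathfrak t_n=\theta_1,\dots,\theta_n$ in $S$ put $g_{\mathfrak t_n}=g_{\theta_n}\circ\dots\circ g_{\theta_1}$, and let $\varphi_n\in\mathrm{Out}(F_r)$ be the outer class of $\theta_n\circ\dots\circ\theta_1$, which is represented by $g_{\mathfrak t_n}$. For a graph map $g:R_r\to R_r$ let $M(g)$ be the $r\times r$ matrix whose $(i,j)$ entry is the number of occurrences of $e_i$ and $\overline{e_i}$ in $g(e_j)$, let $\|M(g)\|$ be its Euclidean operator norm, and let $\lambda(g)$ be its spectral radius. For $\varphi\in\mathrm{Out}(F_r)$ the stretch factor is $\lambda(\varphi)=\sup_{1\ne w\in F_r}\limsup_{k\to\infty}\|\varphi^k(w)\|_A^{1/k}$, where $\|\cdot\|_A$ is the cyclically reduced length with respect to $A$. Theorem. There is a real number $\ell_1>0$ (the top Lyapunov exponent of the walk) such that for $\mu_{\mathcal W}$-a.e. trajectory $\theta_1,\theta_2,\dots$ $$\lim_{n\to\infty}\tfrac1n\log\|M(g_{\mathfrak t_n})\|=\ell_1 ,$$ and such that for $\mu_{\mathcal W}$-a.e.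 trajectory $\theta_1,\theta_2,\dots$ the following hold. (1) $$0<\frac{\ell_1}2\le\liminf_{n\to\infty}\frac1n\log\lambda(g_{\mathfrak t_n})\le\limsup_{n\to\infty}\frac1n\log\lambda(g_{\mathfrak t_n})\le\ell_1 .$$ (2) For every strictly increasing sequence of indices $1\le n_1<n_2<\cdots$ such that $\mathfrak t_{n_i}=\theta_1,\dots,\theta_{n_i}$ is cyclically admissible for every $i\ge1$, $$0<\frac{\ell_1}2\le\liminf_{i\to\infty}\frac1{n_i}\log\lambda(\varphi_{n_i})\le\limsup_{i\to\infty}\frac1{n_i}\log\lambda(\varphi_{n_i})\le\ell_1 .$$ -/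

import Mathlib

open Filter Topology MeasureTheory ProbabilityTheory
open scoped ENNReal

namespace TrainTrackWalk

/-! ### The free group `F_r`, the letters `A^{±1}`, and `Out(F_r)` -/

/-- The free group `F_r` with its distinguished free basis `a_i = FreeGroup.of i`. -/
abbrev F (r : ℕ) : Type := FreeGroup (Fin r)

/-- The set `A^{±1}`; it is also the set of oriented edges of the rose `R_r`.
The letter `(i, true)` is `a_i` (the edge `e_i`), and `(i, false)` is its inverse. -/
abbrev Letter (r : ℕ) : Type := Fin r × Bool

/-- The inverse letter (the edge with the opposite orientation). -/
def Letter.inv {r : ℕ} (x : Letter r) : Letter r := (x.1, !x.2)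

/-- A letter as an element of `F_r`. -/
def Letter.toF {r : ℕ} (x : Letter r) : F r := FreeGroup.mk [x]

lemma Letter.toF_true {r : ℕ} (i : Fin r) : Letter.toF (i, true) = FreeGroup.of i := rfl

lemma Letter.toF_false {r : ℕ} (i : Fin r) : Letter.toF (i, false) = (FreeGroup.of i)⁻¹ := rfl

lemma Letter.toF_inv {r : ℕ} (x : Letter r) : x.inv.toF = x.toF⁻¹ := by
  simp [Letter.toF, Letter.inv, FreeGroup.inv_mk, FreeGroup.invRev]

/-- The inner automorphisms. -/
def Inn (r : ℕ) : Subgroup (MulAut (F r)) := (MulAut.conj : F r →* MulAut (F r)).range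

instance (r : ℕ) : (Inn r).Normal where
  conj_mem := by
    rintro _ ⟨g, rfl⟩ Φ
    refine ⟨Φ g, ?_⟩
    ext x
    simp [MulAut.conj_apply, MulAut.mul_apply]

/-- The outer automorphism group `Out(F_r) = Aut(F_r) / Inn(F_r)`. -/
abbrev Out (r : ℕ) : Type := MulAut (F r) ⧸ Inn r

/-! ### Stretch factors -/

/-- The length of the cyclic reduction of `w`, for one element `w` of `F_r`. -/
def cycLenAux {r : ℕ} (w : F r) : ℕ := (FreeGroup.reduceCyclically w.toWord).length

lemma norm_pow_eq {r : ℕ} (w : F r) (n : ℕ) (hn : n ≠ 0) :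
    (w ^ n).norm = 2 * (FreeGroup.reduceCyclically.conjugator w.toWord).length
      + n * cycLenAux w := by
  rw [FreeGroup.norm, FreeGroup.toWord_pow,
    FreeGroup.reduceCyclically.reduce_flatten_replicate FreeGroup.isReduced_toWord, if_neg hn]
  simp [cycLenAux]
  ring

lemma cycLenAux_le_of_conj {r : ℕ} (w h : F r) : cycLenAux (h * w * h⁻¹) ≤ cycLenAux w := by
  by_contra hlt
  push Not at hlt
  set K := 2 * h.norm + 2 * (FreeGroup.reduceCyclically.conjugator w.toWord).length with hK
  have h1 := norm_pow_eq (h * w * h⁻¹) (K + 1) (by omega)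
  have h2 := norm_pow_eq w (K + 1) (by omega)
  have h3 : ((h * w * h⁻¹) ^ (K + 1)).norm ≤ 2 * h.norm + (w ^ (K + 1)).norm := by
    rw [conj_pow]
    have e1 := FreeGroup.norm_mul_le (h * w ^ (K + 1)) h⁻¹
    have e2 := FreeGroup.norm_mul_le h (w ^ (K + 1))
    rw [FreeGroup.norm_inv_eq] at e1
    omega
  have h4 : (K + 1) * (cycLenAux w + 1) ≤ (K + 1) * cycLenAux (h * w * h⁻¹) :=
    Nat.mul_le_mul_left _ hlt
  rw [Nat.mul_add] at h4
  omega

lemma cycLenAux_eq_of_isConj {r : ℕ} {u w : F r} (h : IsConj u w) :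
    cycLenAux u = cycLenAux w := by
  obtain ⟨c, rfl⟩ := isConj_iff.1 h
  refine le_antisymm ?_ (cycLenAux_le_of_conj u c)
  have := cycLenAux_le_of_conj (c * u * c⁻¹) c⁻¹
  simpa [mul_assoc] using this

/-- The cyclically reduced length `‖w‖_A`, as a function of the conjugacy class of `w`. -/
def cycLen {r : ℕ} (c : ConjClasses (F r)) : ℕ :=
  Quotient.lift cycLenAux (fun _ _ h => cycLenAux_eq_of_isConj h) c

/-- The action of an outer automorphism on the conjugacy classes of `F_r`. -/
def Out.act {r : ℕ} (φ : Out r) (c : ConjClasses (F r)) : ConjClasses (F r) :=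
  Quotient.liftOn' φ (fun Φ => ConjClasses.map Φ.toMonoidHom c) (by
    intro Φ Ψ h
    rw [QuotientGroup.leftRel_apply] at h
    obtain ⟨g, hg⟩ := h
    have hΨ : Ψ = Φ * MulAut.conj g := by rw [hg]; group
    subst hΨ
    induction c using Quotient.inductionOn with
    | h w =>
      refine ConjClasses.mk_eq_mk_iff_isConj.2 (isConj_iff.2 ⟨Φ g, ?_⟩)
      simp [MulAut.conj_apply, MulAut.mul_apply])

/-- `λ(φ, w) = limsup_n ‖φ^n(w)‖^{1/n}`. -/
noncomputable def stretchAt {r : ℕ} (φ : Out r) (w : F r) : ℝ≥0∞ :=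
  limsup (fun n : ℕ =>
    ((cycLen (Out.act (φ ^ n) (ConjClasses.mk w)) : ℕ) : ℝ≥0∞) ^ (1 / (n : ℝ))) atTop

/-- The stretch factor `λ(φ) = sup_{w ≠ 1} λ(φ, w)`. -/
noncomputable def stretch {r : ℕ} (φ : Out r) : ℝ≥0∞ :=
  ⨆ w : {w : F r // w ≠ 1}, stretchAt φ w

/-! ### Graph maps of the rose -/

/-- A graph map `R_r → R_r` of the `r`-rose, given by the edge-paths of positive length that are
the images of the oriented edges `e_1, …, e_r`. These edge-paths need not be reduced. -/
@[ext] structure RoseMap (r : ℕ) where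
  path : Fin r → List (Letter r)
  path_ne_nil : ∀ i, path i ≠ []

namespace RoseMap

variable {r : ℕ}

/-- The image of an arbitrary oriented edge: opposite edges have opposite images. -/
def edgePath (f : RoseMap r) (e : Letter r) : List (Letter r) :=
  if e.2 then f.path e.1 else FreeGroup.invRev (f.path e.1)

lemma edgePath_ne_nil (f : RoseMap r) (e : Letter r) : f.edgePath e ≠ [] := by
  unfold edgePath
  split
  · exact f.path_ne_nil _
  · simp [FreeGroup.invRev, f.path_ne_nil]

/-- The identity map of the rose. -/
def id (r : ℕ) : RoseMap r where
  path i := [(i, true)]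
  path_ne_nil i := by simp

/-- Composition `f ∘ g` (no cancellation is performed). -/
def comp (f g : RoseMap r) : RoseMap r where
  path i := (g.path i).flatMap f.edgePath
  path_ne_nil i := by
    obtain ⟨e, he⟩ := List.exists_mem_of_ne_nil _ (g.path_ne_nil i)
    simp only [ne_eq, List.flatMap_eq_nil_iff, not_forall]
    exact ⟨e, he, f.edgePath_ne_nil e⟩

/-- The transition matrix: the `(i, j)` entry is the number of occurrences of `e_i` and of its
inverse in the edge-path `f(e_j)`. -/
def transitionMatrix (f : RoseMap r) : Matrix (Fin r) (Fin r) ℕ :=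
  Matrix.of fun i j => (f.path j).countP (fun e => e.1 = i)

/-- `λ(f)`, the spectral radius of the transition matrix: the maximum of the moduli of its complex
eigenvalues. -/
noncomputable def specRadius (f : RoseMap r) : ℝ≥0∞ :=
  spectralRadius ℂ (f.transitionMatrix.map (Nat.cast : ℕ → ℂ))

/-- The Euclidean operator norm `‖M(f)‖` of the transition matrix. -/
noncomputable def matrixNorm (f : RoseMap r) : ℝ :=
  ‖Matrix.toEuclideanCLM (n := Fin r) (𝕜 := ℝ) (f.transitionMatrix.map (Nat.cast : ℕ → ℝ))‖

/-- The standard representative `g_Φ` of an automorphism `Φ`: the edge `e_i` is sent to the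
edge-path that spells the freely reduced word of `Φ(a_i)`. -/
def standardRep (Φ : MulAut (F r)) : RoseMap r where
  path i := (Φ (FreeGroup.of i)).toWord
  path_ne_nil i := by simp [FreeGroup.toWord_eq_nil_iff, FreeGroup.of_ne_one]

/-- The map `f` of the rose induces the outer automorphism `φ` of `π_1(R_r) = F_r`. -/
def Represents (f : RoseMap r) (φ : Out r) : Prop :=
  ∃ Φ : MulAut (F r), (∀ i, Φ (FreeGroup.of i) = FreeGroup.mk (f.path i)) ∧
    (QuotientGroup.mk Φ : Out r) = φ

end RoseMap

/-! ### Standard Nielsen automorphisms and admissible sequences -/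

/-- The set `S` of standard Nielsen automorphisms `[x ↦ yx]`, encoded by their characteristic
pairs `(x, y)`, where `y ≠ x^{±1}`. -/
def Nielsen (r : ℕ) : Type := {p : Letter r × Letter r // p.2 ≠ p.1 ∧ p.2 ≠ p.1.inv}

namespace Nielsen

variable {r : ℕ}

instance : Fintype (Nielsen r) :=
  inferInstanceAs (Fintype {p : Letter r × Letter r // p.2 ≠ p.1 ∧ p.2 ≠ p.1.inv})

instance : DecidableEq (Nielsen r) :=
  inferInstanceAs (DecidableEq {p : Letter r × Letter r // p.2 ≠ p.1 ∧ p.2 ≠ p.1.inv})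

instance : MeasurableSpace (Nielsen r) := ⊤

instance : DiscreteMeasurableSpace (Nielsen r) := ⟨fun _ => trivial⟩

/-- The letter `x` of `[x ↦ yx]`. -/
def x (θ : Nielsen r) : Letter r := θ.1.1

/-- The letter `y` of `[x ↦ yx]`. -/
def y (θ : Nielsen r) : Letter r := θ.1.2

/-- The endomorphism of `F_r` that sends the letter `x` to `g * x` and fixes the basis elements
other than `x^{±1}`. -/
def leftMul (x : Letter r) (g : F r) : F r →* F r :=
  FreeGroup.lift fun i =>
    if i = x.1 then (if x.2 then g * FreeGroup.of i else FreeGroup.of i * g⁻¹)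
    else FreeGroup.of i

lemma leftMul_toF_self (x : Letter r) (g : F r) : leftMul x g x.toF = g * x.toF := by
  obtain ⟨i, b⟩ := x
  cases b
  · simp [leftMul, Letter.toF_false]
  · simp [leftMul, Letter.toF_true]

lemma leftMul_toF_of_ne (x z : Letter r) (g : F r) (h : z.1 ≠ x.1) :
    leftMul x g z.toF = z.toF := by
  obtain ⟨i, b⟩ := z
  cases b
  · simp_all [leftMul, Letter.toF_false]
  · simp_all [leftMul, Letter.toF_true]

lemma leftMul_comp (x y : Letter r) (h : y.1 ≠ x.1) :
    (leftMul x y.toF⁻¹).comp (leftMul x y.toF) = MonoidHom.id (F r) := by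
  have hy := leftMul_toF_of_ne x y y.toF⁻¹ h
  have hx := leftMul_toF_self x y.toF
  have hx' := leftMul_toF_self x y.toF⁻¹
  have key : leftMul x y.toF⁻¹ (leftMul x y.toF x.toF) = x.toF := by
    rw [hx, map_mul, hy, hx', mul_inv_cancel_left]
  ext i
  rw [MonoidHom.comp_apply, MonoidHom.id_apply]
  by_cases hi : i = x.1
  · obtain ⟨j, b⟩ := x
    simp only at hi
    subst hi
    cases b
    · rw [Letter.toF_false, map_inv, map_inv, inv_inj] at key
      exact key
    · exact key
  · have e1 : ∀ g, leftMul x g (FreeGroup.of i) = FreeGroup.of i :=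
      fun g => leftMul_toF_of_ne x (i, true) g hi
    rw [e1, e1]

lemma fst_ne (θ : Nielsen r) : θ.y.1 ≠ θ.x.1 := by
  obtain ⟨⟨⟨i, b⟩, ⟨j, c⟩⟩, h1, h2⟩ := θ
  intro h
  change j = i at h
  subst h
  cases b <;> cases c <;> simp_all [Letter.inv]

/-- The automorphism `[x ↦ yx]` of `F_r`. -/
def toAut (θ : Nielsen r) : MulAut (F r) :=
  MonoidHom.toMulEquiv (leftMul θ.x θ.y.toF) (leftMul θ.x θ.y.toF⁻¹)
    (leftMul_comp θ.x θ.y θ.fst_ne)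
    (by
      have := leftMul_comp θ.x θ.y.inv θ.fst_ne
      rwa [Letter.toF_inv, inv_inv] at this)

lemma toAut_x (θ : Nielsen r) : θ.toAut θ.x.toF = θ.y.toF * θ.x.toF :=
  leftMul_toF_self _ _

lemma toAut_of_ne (θ : Nielsen r) (z : Letter r) (h : z ≠ θ.x) (h' : z ≠ θ.x.inv) :
    θ.toAut z.toF = z.toF :=
  leftMul_toF_of_ne _ _ _ (fst_ne ⟨(θ.x, z), h, h'⟩)

/-- The standard representative `g_θ : R_r → R_r`. -/
def roseMap (θ : Nielsen r) : RoseMap r := RoseMap.standardRep θ.toAut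

/-- The ordered pair `(θ, θ')` is admissible. -/
def Admissible (θ θ' : Nielsen r) : Prop :=
  (θ'.x = θ.x ∧ θ'.y ≠ θ.y.inv) ∨ (θ'.y = θ.x ∧ θ'.x ≠ θ.y.inv)

instance (θ θ' : Nielsen r) : Decidable (Admissible θ θ') :=
  inferInstanceAs (Decidable ((θ'.x = θ.x ∧ θ'.y ≠ θ.y.inv) ∨ (θ'.y = θ.x ∧ θ'.x ≠ θ.y.inv)))

end Nielsen

variable {r : ℕ}

/-- The sequence `𝔱 = θ_1, …, θ_n` is cyclically admissible: it is nonempty, all pairs of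
consecutive terms are admissible, and so is the pair `(θ_n, θ_1)`. -/
def CyclicallyAdmissible (t : List (Nielsen r)) : Prop :=
  ∃ h : t ≠ [], t.IsChain Nielsen.Admissible ∧ Nielsen.Admissible (t.getLast h) (t.head h)

/-- The graph map `g_𝔱 = g_{θ_n} ∘ ⋯ ∘ g_{θ_1}` of a sequence `𝔱 = θ_1, …, θ_n`. -/
def seqRoseMap (t : List (Nielsen r)) : RoseMap r :=
  t.foldl (fun g θ => θ.roseMap.comp g) (RoseMap.id r)

/-- The outer class of `θ_n ∘ ⋯ ∘ θ_1`, for a sequence `𝔱 = θ_1, …, θ_n`. -/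
def seqOut (t : List (Nielsen r)) : Out r :=
  QuotientGroup.mk (t.foldl (fun Φ θ => θ.toAut * Φ) 1)

lemma seq_aux (t : List (Nielsen r)) (f : RoseMap r) (Φ : MulAut (F r))
    (h : ∀ i, Φ (FreeGroup.of i) = FreeGroup.mk (f.path i)) (i : Fin r) :
    (t.foldl (fun Φ θ => θ.toAut * Φ) Φ) (FreeGroup.of i) =
      FreeGroup.mk ((t.foldl (fun g θ => θ.roseMap.comp g) f).path i) := by
  induction t generalizing f Φ with
  | nil => exact h i
  | cons θ t ih =>
    refine ih _ _ fun j => ?_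
    rw [MulAut.mul_apply, h j]
    have key : ∀ L : List (Letter r), θ.toAut (FreeGroup.mk L) =
        FreeGroup.mk (L.flatMap θ.roseMap.edgePath) := by
      intro L
      induction L with
      | nil => exact map_one _
      | cons e L ihL =>
        have : (FreeGroup.mk (e :: L) : F r) = Letter.toF e * FreeGroup.mk L := by
          simp [Letter.toF, FreeGroup.mul_mk]
        rw [this, map_mul, ihL, List.flatMap_cons, ← FreeGroup.mul_mk]
        congr 1
        obtain ⟨k, b⟩ := e
        cases b
        · simp [Letter.toF_false, Nielsen.roseMap, RoseMap.standardRep, RoseMap.edgePath,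
            FreeGroup.mk_toWord, ← FreeGroup.inv_mk]
        · simp [Letter.toF_true, Nielsen.roseMap, RoseMap.standardRep, RoseMap.edgePath,
            FreeGroup.mk_toWord]
    exact key _

/-- `g_𝔱` represents the outer class of `θ_n ∘ ⋯ ∘ θ_1`. -/
lemma seqRoseMap_represents (t : List (Nielsen r)) : (seqRoseMap t).Represents (seqOut t) :=
  ⟨_, seq_aux t (RoseMap.id r) 1 (fun _ => rfl), rfl⟩

/-- The initial segment `𝔱_n = θ_1, …, θ_n` of a trajectory. A trajectory is indexed from `0`, so
that `θ_k = ω (k - 1)`. -/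
def initialSegment (ω : ℕ → Nielsen r) (n : ℕ) : List (Nielsen r) := (List.range n).map ω

/-! ### The random walk -/

/-- The transition probability `P(θ' | θ)`. -/
noncomputable def transProb (θ θ' : Nielsen r) : ℝ≥0∞ :=
  if Nielsen.Admissible θ θ' then ((4 * r - 6 : ℕ) : ℝ≥0∞)⁻¹ else 0

/-- Each state has exactly `4r - 6` admissible successors. -/
lemma card_admissible (θ : Nielsen r) :
    (Finset.univ.filter (Nielsen.Admissible θ)).card = 4 * r - 6 := by
  have hθ := θ.fst_ne
  obtain ⟨x, hx⟩ : ∃ x, x = θ.x := ⟨_, rfl⟩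
  obtain ⟨y, hy⟩ : ∃ y, y = θ.y := ⟨_, rfl⟩
  rw [← hx, ← hy] at hθ
  have hT : ((({x, x.inv, y.inv} : Finset (Letter r))ᶜ).card) = 2 * r - 3 := by
    rw [Finset.card_compl, Finset.card_eq_three.2 ⟨x, x.inv, y.inv, ?_, ?_, ?_, rfl⟩]
    · simp; omega
    · intro h; simpa [Letter.inv] using congrArg Prod.snd h
    · intro h; exact hθ (congrArg Prod.fst h).symm
    · intro h; exact hθ (congrArg Prod.fst h).symm
  set T := ((({x, x.inv, y.inv} : Finset (Letter r))ᶜ)) with hTdef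
  have hinv : ∀ u v : Letter r, u = v.inv ↔ v = u.inv := by
    rintro ⟨i, b⟩ ⟨j, c⟩
    cases b <;> cases c <;> simp [Letter.inv, eq_comm]
  have hmem : ∀ z, z ∈ T ↔ z ≠ x ∧ z ≠ x.inv ∧ z ≠ y.inv := by
    intro z; simp [hTdef]
  have hset : (Finset.univ.filter (Nielsen.Admissible θ)).map
      (⟨fun θ => θ.1, Subtype.val_injective⟩ : Nielsen r ↪ Letter r × Letter r) =
      T.image (fun z => (x, z)) ∪ T.image (fun z => (z, x)) := by
    ext ⟨u, v⟩
    simp only [Finset.mem_map, Finset.mem_filter, Finset.mem_univ, true_and, Finset.mem_union,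
      Finset.mem_image, Prod.mk.injEq]
    constructor
    · rintro ⟨η, hA, hp⟩
      obtain ⟨g1, g2⟩ := η.2
      have hu : η.x = u := congrArg Prod.fst hp
      have hv : η.y = v := congrArg Prod.snd hp
      change η.y ≠ η.x at g1
      change η.y ≠ η.x.inv at g2
      rw [Nielsen.Admissible, ← hx, ← hy] at hA
      rw [hu, hv] at hA g1 g2
      rcases hA with ⟨rfl, hb⟩ | ⟨rfl, hb⟩
      · exact Or.inl ⟨v, (hmem _).2 ⟨g1, g2, hb⟩, rfl, rfl⟩
      · exact Or.inr ⟨u, (hmem _).2 ⟨Ne.symm g1, fun h => g2 ((hinv _ _).1 h), hb⟩, rfl, rfl⟩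
    · rintro (⟨z, hz, rfl, rfl⟩ | ⟨z, hz, rfl, rfl⟩)
      · obtain ⟨a1, a2, a3⟩ := (hmem _).1 hz
        refine ⟨⟨(x, z), a1, a2⟩, Or.inl ?_, rfl⟩
        rw [← hx, ← hy]
        exact ⟨rfl, a3⟩
      · obtain ⟨a1, a2, a3⟩ := (hmem _).1 hz
        refine ⟨⟨(z, x), Ne.symm a1, fun h => a2 ((hinv _ _).1 h)⟩, Or.inr ?_, rfl⟩
        rw [← hx, ← hy]
        exact ⟨rfl, a3⟩
  have hcard := congrArg Finset.card hset
  rw [Finset.card_map, Finset.card_union_of_disjoint, Finset.card_image_of_injective,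
    Finset.card_image_of_injective, hT] at hcard
  · rw [hcard]; omega
  · intro a b h; exact (Prod.mk.inj h).1
  · intro a b h; exact (Prod.mk.inj h).2
  · rw [Finset.disjoint_left]
    intro p hp hq
    simp only [Finset.mem_image] at hp hq
    obtain ⟨z, hz, rfl⟩ := hp
    obtain ⟨z', hz', h⟩ := hq
    exact ((hmem _).1 hz').1 (Prod.mk.inj h).1

lemma sum_transProb (θ : Nielsen r) : ∑ θ', transProb θ θ' = 1 := by
  have hr : 2 ≤ r := by
    have := θ.fst_ne
    have h1 := θ.x.1.2
    have h2 := θ.y.1.2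
    by_contra h
    exact this (Fin.ext (by omega))
  unfold transProb
  rw [← Finset.sum_filter, Finset.sum_const, card_admissible, nsmul_eq_mul]
  exact ENNReal.mul_inv_cancel (Nat.cast_ne_zero.2 (by omega)) (ENNReal.natCast_ne_top _)

/-- The transition probabilities out of `θ`, as a probability distribution on `S`. -/
noncomputable def transPMF (θ : Nielsen r) : PMF (Nielsen r) :=
  PMF.ofFintype (transProb θ) (sum_transProb θ)

/-- The transition kernel of the Markov chain. -/
noncomputable def stepKernel (r : ℕ) : Kernel (Nielsen r) (Nielsen r) where
  toFun θ := (transPMF θ).toMeasure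
  measurable' := measurable_of_finite _

instance : IsMarkovKernel (stepKernel r) := ⟨fun θ => by
  change IsProbabilityMeasure (transPMF θ).toMeasure
  infer_instance⟩

/-- `μ_W`: the law on `S^ℕ` of the Markov chain with uniform initial distribution and with the
transition probabilities `P(θ' | θ)`. -/
noncomputable def walkMeasure (r : ℕ) : Measure (ℕ → Nielsen r) :=
  Kernel.trajMeasure (X := fun _ => Nielsen r) (uniformOn Set.univ)
    fun n => (stepKernel r).comap (fun h => h ⟨n, Finset.mem_Iic.2 le_rfl⟩) (by fun_prop)

/-- The law of the walk on cylinders: `μ_W(θ_1 = s_1, …, θ_{n+1} = s_{n+1})` is the product of the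
initial probability and of the transition probabilities. -/
lemma walkMeasure_cylinder (hr : 3 ≤ r) (s : ℕ → Nielsen r) (n : ℕ) :
    walkMeasure r {ω | ∀ i ≤ n, ω i = s i} =
      (Fintype.card (Nielsen r) : ℝ≥0∞)⁻¹ * ∏ i ∈ Finset.range n, transProb (s i) (s (i+1)) := by
  have hne : Nonempty (Nielsen r) :=
    ⟨⟨((⟨0, by omega⟩, true), (⟨1, by omega⟩, true)), by simp [Letter.inv]⟩⟩
  have : IsProbabilityMeasure (uniformOn (Set.univ : Set (Nielsen r))) :=
    isProbabilityMeasure_uniformOn Set.finite_univ Set.univ_nonempty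
  induction n with
  | zero =>
    have hset : {ω : ℕ → Nielsen r | ∀ i ≤ 0, ω i = s i} =
        Preorder.frestrictLe 0 ⁻¹' {h : (Π _ : Finset.Iic 0, Nielsen r) | ∀ i, h i = s i.1} :=
      Set.ext fun ω => ⟨fun h i => h i.1 (Finset.mem_Iic.1 i.2),
        fun h i hi => h ⟨i, Finset.mem_Iic.2 hi⟩⟩
    have hpre : (MeasurableEquiv.piUnique fun _ : Finset.Iic 0 => Nielsen r).symm ⁻¹'
        {h | ∀ i, h i = s i.1} = {s 0} := by
      ext θ
      constructor
      · intro h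
        exact h ⟨0, Finset.mem_Iic.2 le_rfl⟩
      · rintro rfl ⟨i, hi⟩
        obtain rfl : i = 0 := Nat.le_zero.1 (Finset.mem_Iic.1 hi)
        rfl
    rw [hset, ← Measure.map_apply (by fun_prop) MeasurableSet.of_discrete, walkMeasure,
      Kernel.trajMeasure, Measure.map_comp _ _ (by fun_prop), Kernel.traj_map_frestrictLe,
      Kernel.partialTraj_self, Measure.id_comp,
      Measure.map_apply (by fun_prop) MeasurableSet.of_discrete, hpre]
    simp [uniformOn_univ]
  | succ n ih =>
    have hs1 : {ω : ℕ → Nielsen r | ∀ i ≤ n + 1, ω i = s i} =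
        (fun x => (Preorder.frestrictLe n x, x (n + 1))) ⁻¹'
          ({h : (Π _ : Finset.Iic n, Nielsen r) | ∀ i, h i = s i.1} ×ˢ {s (n + 1)}) := by
      ext ω
      constructor
      · intro h
        exact ⟨fun i => h i.1 ((Finset.mem_Iic.1 i.2).trans (Nat.le_succ n)), h _ le_rfl⟩
      · rintro ⟨h, h'⟩ i hi
        rcases Nat.le_succ_iff.1 hi with h1 | rfl
        · exact h ⟨i, Finset.mem_Iic.2 h1⟩
        · exact h'
    have hs2 : {ω : ℕ → Nielsen r | ∀ i ≤ n, ω i = s i} =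
        Preorder.frestrictLe n ⁻¹' {h : (Π _ : Finset.Iic n, Nielsen r) | ∀ i, h i = s i.1} :=
      Set.ext fun ω => ⟨fun h i => h i.1 (Finset.mem_Iic.1 i.2),
        fun h i hi => h ⟨i, Finset.mem_Iic.2 hi⟩⟩
    have key := Kernel.map_frestrictLe_trajMeasure_compProd_eq_map_trajMeasure
      (X := fun _ => Nielsen r) (μ₀ := uniformOn Set.univ) (a := n)
      (κ := fun n => (stepKernel r).comap (fun h => h ⟨n, Finset.mem_Iic.2 le_rfl⟩) (by fun_prop))
    have hA : MeasurableSet {h : (Π i : Finset.Iic n, Nielsen r) | ∀ i : Finset.Iic n, h i = s i.1} := by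
      exact MeasurableSet.of_discrete
    have k2 := congrArg (fun m => m ({h : (Π i : Finset.Iic n, Nielsen r) | ∀ i : Finset.Iic n, h i = s i.1} ×ˢ {s (n+1)})) key
    rw [Measure.map_apply (by fun_prop) (hA.prod (MeasurableSet.singleton _)),
      Measure.compProd_apply_prod hA (MeasurableSet.singleton _),
      setLIntegral_congr_fun (g := fun _ => transProb (s n) (s (n+1))) hA, MeasureTheory.setLIntegral_const, Measure.map_apply (by fun_prop) hA] at k2
    · rw [Finset.prod_range_succ, ← mul_assoc, ← ih, mul_comm]
      rw [hs1, hs2]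
      exact k2.symm
    · intro h hh
      have : h ⟨n, Finset.mem_Iic.2 le_rfl⟩ = s n := hh _
      simp only [Kernel.comap_apply, this]
      change (transPMF (s n)).toMeasure {s (n+1)} = _
      rw [PMF.toMeasure_apply_singleton _ _ (MeasurableSet.singleton _)]
      rfl
end TrainTrackWalk

open TrainTrackWalk

/-!
The transition matrix of `[x ↦ yx]` is the elementary matrix `1 + E_{|y|,|x|}`, and `M(g_𝔱)` is the
product of these matrices. All of them dominate the identity entrywise, so entries only grow along
a trajectory. The sum of the entries (`entrySum`) is a submultiplicative norm, and it is
supermultiplicative across a factor without zero entries (`entrySum_mul_entrySum_le`). A sequence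
that visits all states gives such a factor (`seqMatrix_pos`).

**The Lyapunov exponent.** The uniform distribution and the transition probabilities are realised
by independent random maps of the state space (`walkMeasure_eq`): each selection chooses an
admissible successor for every state. By irreducibility there are *resetting* words of selections
(`exists_resetting`), which bring all states to the same state and visit all states on the way.
Divide the selections into blocks of length `L = q + q ^ 2`. If the first `q` selections of a block
form a resetting word, the remaining part of the block contributes an amount `blockGain` that
neither depends on the past nor is lost in the product. In all cases the block
contributes at most `blockGain + blockError`. The two bounds are functions of independent
identically distributed blocks, so the strong law of large numbers bounds the growth rate from
below and from above by constants. As resetting words occur almost surely, the mean of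
`blockError / L` tends to `0` as `q` grows, and the two constants meet (`exists_lyapunov_driving`).
No subadditive ergodic theorem is needed.

**Spectral radii.** By the law of large numbers a fixed resetting word occurs, for all large `n`,
in the second half of `θ_1, …, θ_n`. It makes some diagonal entry of `M(g_{𝔱_n})` at least a constant
times the size of `M(g_{𝔱_k})` for some `k` close to `n / 2` (`exists_diag_bound`), which is the
origin of the bound `ℓ₁ / 2`. A diagonal entry is at most the spectral radius by Gelfand's formula
(`RoseMap.diag_le_specRadius`), and the spectral radius is at most `entrySum`.

**Stretch factors.** The only illegal turn of `[x ↦ yx]` is `{x, y}`, and the image of its direction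
map misses `x`. Admissibility says that the illegal turn of the next automorphism contains `x` and is
not the turn inside the edge-path `yx`. Therefore images of legal loops are legal for the next map
(`LegalLoop.image`). If `𝔱` is cyclically admissible, this applies to all powers of `g_𝔱` and to the
loops `a_i`, whose images are then cyclically reduced, of length a column sum of a power of `M(g_𝔱)`.
So the diagonal entries of `M(g_𝔱)` are lower bounds for the stretch factor as well
(`diag_le_stretch`), while the growth of word lengths bounds it by `entrySum`
(`RoseMap.Represents.stretch_le`).
-/

namespace TrainTrackWalk

/-! ### Edge-paths and transition matrices -/

lemma Letter.inv_inv {r : ℕ} (x : Letter r) : x.inv.inv = x := by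
  simp [Letter.inv]

lemma Letter.inv_ne {r : ℕ} (x : Letter r) : x.inv ≠ x := by
  intro h
  simpa [Letter.inv] using congrArg Prod.snd h

namespace RoseMap

variable {r : ℕ}

lemma edgePath_inv (f : RoseMap r) (e : Letter r) :
    f.edgePath e.inv = FreeGroup.invRev (f.edgePath e) := by
  obtain ⟨i, b⟩ := e
  cases b <;> simp [edgePath, Letter.inv]

lemma standardRep_edgePath (Φ : MulAut (F r)) (e : Letter r) :
    (standardRep Φ).edgePath e = (Φ e.toF).toWord := by
  obtain ⟨i, b⟩ := e
  cases b
  · simp [edgePath, standardRep, Letter.toF_false]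
  · simp [edgePath, standardRep, Letter.toF_true]

lemma countP_edgePath (f : RoseMap r) (e : Letter r) (i : Fin r) :
    (f.edgePath e).countP (fun z => z.1 = i) = f.transitionMatrix i e.1 := by
  obtain ⟨j, b⟩ := e
  cases b
  · simp [edgePath, transitionMatrix, FreeGroup.invRev, Function.comp_def, List.countP_map]
  · simp [edgePath, transitionMatrix]

/-- The abelianised letter count of `f(w)` is the transition matrix of `f` applied to the letter
count of `w`. -/
lemma countP_flatMap_edgePath (f : RoseMap r) (w : List (Letter r)) (i : Fin r) :
    (w.flatMap f.edgePath).countP (fun z => z.1 = i) =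
      ∑ j, f.transitionMatrix i j * w.countP (fun z => z.1 = j) := by
  induction w with
  | nil => simp
  | cons e w ih =>
    rw [List.flatMap_cons, List.countP_append, ih, countP_edgePath]
    simp only [List.countP_cons, Nat.mul_add, Finset.sum_add_distrib]
    simp [add_comm]

lemma length_eq_sum_countP (w : List (Letter r)) :
    w.length = ∑ i, w.countP (fun z => z.1 = i) := by
  induction w with
  | nil => simp
  | cons e w ih => simp [List.countP_cons, Finset.sum_add_distrib, ih]

lemma flatMap_comp (f g : RoseMap r) (w : List (Letter r)) :
    w.flatMap (f.comp g).edgePath = (w.flatMap g.edgePath).flatMap f.edgePath := by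
  rw [List.flatMap_assoc]
  congr 1
  funext ⟨i, b⟩
  cases b
  · simp only [edgePath, comp, Bool.false_eq_true, if_false]
    generalize g.path i = L
    induction L with
    | nil => simp [FreeGroup.invRev]
    | cons e L ih =>
      have h : ∀ A B : List (Letter r),
          FreeGroup.invRev (A ++ B) = FreeGroup.invRev B ++ FreeGroup.invRev A := by
        simp [FreeGroup.invRev]
      have h' : FreeGroup.invRev (e :: L) = FreeGroup.invRev L ++ [e.inv] := by
        simp [FreeGroup.invRev, Letter.inv]
      have ih' : FreeGroup.invRev (L.flatMap f.edgePath) =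
          (FreeGroup.invRev L).flatMap f.edgePath := ih
      change FreeGroup.invRev ((e :: L).flatMap f.edgePath) =
        (FreeGroup.invRev (e :: L)).flatMap f.edgePath
      rw [List.flatMap_cons, h, h', List.flatMap_append, ih', List.flatMap_singleton, edgePath_inv]
  · simp only [edgePath, comp, if_true]

lemma transitionMatrix_comp (f g : RoseMap r) :
    (f.comp g).transitionMatrix = f.transitionMatrix * g.transitionMatrix := by
  ext i j
  rw [Matrix.mul_apply]
  exact countP_flatMap_edgePath f (g.path j) i

lemma transitionMatrix_id : (id r).transitionMatrix = 1 := by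
  ext i j
  simp [transitionMatrix, id, Matrix.one_apply, List.countP_cons, eq_comm]

lemma edgePath_id (w : List (Letter r)) : w.flatMap (id r).edgePath = w := by
  have : (id r).edgePath = fun e => [e] := by
    funext ⟨i, b⟩
    cases b <;> simp [edgePath, id, FreeGroup.invRev]
  rw [this, List.flatMap_singleton']

end RoseMap

namespace Nielsen

variable {r : ℕ}

lemma inv_y_ne_x (θ : Nielsen r) : θ.y.inv ≠ θ.x := fun h =>
  θ.fst_ne (show θ.y.inv.1 = θ.x.1 from congrArg Prod.fst h)

lemma edgePath_x (θ : Nielsen r) : θ.roseMap.edgePath θ.x = [θ.y, θ.x] := by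
  rw [roseMap, RoseMap.standardRep_edgePath, toAut_x, Letter.toF, Letter.toF, FreeGroup.mul_mk,
    FreeGroup.toWord_mk]
  apply FreeGroup.IsReduced.reduce_eq
  simp [θ.fst_ne]

lemma edgePath_inv_x (θ : Nielsen r) :
    θ.roseMap.edgePath θ.x.inv = [θ.x.inv, θ.y.inv] := by
  rw [RoseMap.edgePath_inv, edgePath_x]
  simp [FreeGroup.invRev, Letter.inv]

lemma edgePath_of_ne (θ : Nielsen r) (z : Letter r) (h : z ≠ θ.x) (h' : z ≠ θ.x.inv) :
    θ.roseMap.edgePath z = [z] := by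
  rw [roseMap, RoseMap.standardRep_edgePath, toAut_of_ne θ z h h', Letter.toF,
    FreeGroup.toWord_mk, FreeGroup.reduce_singleton]

/-- The transition matrix of `[x ↦ yx]` is elementary. -/
lemma transitionMatrix_roseMap (θ : Nielsen r) :
    θ.roseMap.transitionMatrix = 1 + Matrix.single θ.y.1 θ.x.1 1 := by
  ext i j
  rw [show j = ((j, true) : Letter r).1 from rfl, ← RoseMap.countP_edgePath]
  have hne := θ.fst_ne
  by_cases h : j = θ.x.1
  · have e1 : (θ.roseMap.edgePath (j, true)).countP (fun z => z.1 = i) =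
        (θ.roseMap.edgePath θ.x).countP (fun z => z.1 = i) := by
      rw [RoseMap.countP_edgePath, RoseMap.countP_edgePath, h]
    rw [e1, edgePath_x]
    simp [h, List.countP_cons, Matrix.one_apply, Matrix.single_apply, eq_comm]

  · rw [edgePath_of_ne _ _ (fun hh => h (congrArg Prod.fst hh))
      (fun hh => h (congrArg Prod.fst hh))]
    simp [List.countP_cons, Matrix.one_apply, Matrix.single_apply, eq_comm]
    intro _ h2
    exact absurd h2 h

end Nielsen

variable {r : ℕ}

/-- The transition matrix `M(g_𝔱)`. -/
def seqMatrix (t : List (Nielsen r)) : Matrix (Fin r) (Fin r) ℕ :=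
  (seqRoseMap t).transitionMatrix

lemma seqRoseMap_concat (t : List (Nielsen r)) (θ : Nielsen r) :
    seqRoseMap (t ++ [θ]) = θ.roseMap.comp (seqRoseMap t) := by
  simp [seqRoseMap]

lemma seqMatrix_nil : seqMatrix ([] : List (Nielsen r)) = 1 :=
  RoseMap.transitionMatrix_id

lemma seqMatrix_concat (t : List (Nielsen r)) (θ : Nielsen r) :
    seqMatrix (t ++ [θ]) = θ.roseMap.transitionMatrix * seqMatrix t := by
  rw [seqMatrix, seqRoseMap_concat, RoseMap.transitionMatrix_comp, seqMatrix]

lemma seqMatrix_append (t s : List (Nielsen r)) :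
    seqMatrix (t ++ s) = seqMatrix s * seqMatrix t := by
  induction s using List.reverseRecOn with
  | nil => simp [seqMatrix_nil]
  | append_singleton s θ ih =>
    rw [← List.append_assoc, seqMatrix_concat, ih, seqMatrix_concat, Matrix.mul_assoc]

lemma seqMatrix_singleton (θ : Nielsen r) : seqMatrix [θ] = θ.roseMap.transitionMatrix := by
  have := seqMatrix_concat [] θ
  rwa [seqMatrix_nil, Matrix.mul_one] at this

/-! ### Entry sums of nonnegative matrices -/

/-- The sum of the entries of a matrix with natural entries, used as a submultiplicative norm. -/
def entrySum (A : Matrix (Fin r) (Fin r) ℕ) : ℕ := ∑ i, ∑ j, A i j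

lemma entrySum_mul_le (A B : Matrix (Fin r) (Fin r) ℕ) :
    entrySum (A * B) ≤ entrySum A * entrySum B := by
  have h : ∀ k, (∑ j, B k j) ≤ entrySum B := fun k =>
    Finset.single_le_sum (f := fun k => ∑ j, B k j) (fun _ _ => Nat.zero_le _) (Finset.mem_univ k)
  calc entrySum (A * B) = ∑ i, ∑ k, A i k * ∑ j, B k j := by
        simp only [entrySum, Matrix.mul_apply, Finset.mul_sum]
        exact Finset.sum_congr rfl fun i _ => Finset.sum_comm
    _ ≤ ∑ i, ∑ k, A i k * entrySum B := by gcongr with i _ k _; exact h k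
    _ = entrySum A * entrySum B := by simp only [entrySum, Finset.sum_mul]

lemma entrySum_mono {A B : Matrix (Fin r) (Fin r) ℕ} (h : ∀ i j, A i j ≤ B i j) :
    entrySum A ≤ entrySum B := by
  unfold entrySum
  gcongr with i _ j _
  exact h i j

lemma entrySum_one : entrySum (1 : Matrix (Fin r) (Fin r) ℕ) = r := by
  simp [entrySum, Matrix.one_apply]

lemma mul_apply_mono {A A' B B' : Matrix (Fin r) (Fin r) ℕ} (h : ∀ i j, A i j ≤ A' i j)
    (h' : ∀ i j, B i j ≤ B' i j) (i j : Fin r) : (A * B) i j ≤ (A' * B') i j := by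
  rw [Matrix.mul_apply, Matrix.mul_apply]
  exact Finset.sum_le_sum fun k _ => Nat.mul_le_mul (h i k) (h' k j)

lemma one_le_seqMatrix (t : List (Nielsen r)) :
    ∀ i j, (1 : Matrix (Fin r) (Fin r) ℕ) i j ≤ seqMatrix t i j := by
  induction t using List.reverseRecOn with
  | nil => intro i j; rw [seqMatrix_nil]
  | append_singleton t θ ih =>
    intro i j
    rw [seqMatrix_concat, Nielsen.transitionMatrix_roseMap]
    calc (1 : Matrix (Fin r) (Fin r) ℕ) i j = (1 * 1 : Matrix (Fin r) (Fin r) ℕ) i j := by simp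
      _ ≤ _ := mul_apply_mono (fun i j => by simp) ih i j

lemma le_mul_seqMatrix_right (A : Matrix (Fin r) (Fin r) ℕ) (t : List (Nielsen r)) (i j : Fin r) :
    A i j ≤ (A * seqMatrix t) i j := by
  simpa using mul_apply_mono (A := A) (fun _ _ => le_rfl) (one_le_seqMatrix t) i j

lemma le_seqMatrix_mul_left (A : Matrix (Fin r) (Fin r) ℕ) (t : List (Nielsen r)) (i j : Fin r) :
    A i j ≤ (seqMatrix t * A) i j := by
  simpa using mul_apply_mono (B := A) (one_le_seqMatrix t) (fun _ _ => le_rfl) i j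

lemma le_entrySum_seqMatrix (t : List (Nielsen r)) : r ≤ entrySum (seqMatrix t) := by
  have := entrySum_mono (one_le_seqMatrix t)
  rwa [entrySum_one] at this

lemma entrySum_seqMatrix_append_mono (t s : List (Nielsen r)) :
    entrySum (seqMatrix t) ≤ entrySum (seqMatrix (t ++ s)) := by
  rw [seqMatrix_append]
  exact entrySum_mono (le_seqMatrix_mul_left _ _)

lemma entrySum_seqMatrix_le (t : List (Nielsen r)) :
    entrySum (seqMatrix t) ≤ (r + 1) ^ (t.length + 1) := by
  induction t using List.reverseRecOn with
  | nil => simp [seqMatrix_nil, entrySum_one]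
  | append_singleton t θ ih =>
    have h : entrySum θ.roseMap.transitionMatrix = r + 1 := by
      rw [Nielsen.transitionMatrix_roseMap]
      have : entrySum (1 + Matrix.single θ.y.1 θ.x.1 1) =
        entrySum (1 : Matrix (Fin r) (Fin r) ℕ) + entrySum (Matrix.single θ.y.1 θ.x.1 1) := by
        simp [entrySum, Finset.sum_add_distrib]
      rw [this, entrySum_one]
      simp [entrySum, Matrix.single_apply, ite_and]
    rw [seqMatrix_concat]
    refine (entrySum_mul_le _ _).trans ?_
    rw [h, List.length_append, List.length_singleton, pow_succ _ (t.length + 1), mul_comm]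
    exact Nat.mul_le_mul_right _ ih

/-- If every elementary matrix occurs along `𝔱`, then `M(g_𝔱)` has no zero entry. -/
lemma seqMatrix_pos (t : List (Nielsen r)) (h : ∀ θ, θ ∈ t) (i j : Fin r) :
    1 ≤ seqMatrix t i j := by
  by_cases hij : i = j
  · subst hij
    simpa using one_le_seqMatrix t i i
  · obtain ⟨θ, hx, hy⟩ : ∃ θ : Nielsen r, θ.x = (j, true) ∧ θ.y = (i, true) :=
      ⟨⟨((j, true), (i, true)), by simp [hij], by simp [Letter.inv]⟩, rfl, rfl⟩
    obtain ⟨t₁, t₂, rfl⟩ := List.append_of_mem (h θ)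
    rw [List.append_cons, seqMatrix_append,
      seqMatrix_append, seqMatrix_singleton, Nielsen.transitionMatrix_roseMap]
    refine le_trans ?_ (le_seqMatrix_mul_left _ _ i j)
    refine le_trans ?_ (le_mul_seqMatrix_right _ _ i j)
    simp [hx, hy]

/-- A factor without zero entries makes the entry sum supermultiplicative. -/
lemma entrySum_mul_entrySum_le (A D B : Matrix (Fin r) (Fin r) ℕ) (hD : ∀ i j, 1 ≤ D i j) :
    entrySum A * entrySum B ≤ entrySum (A * D * B) := by
  have e : ∀ i j, (∑ k, A i k) * (∑ l, B l j) ≤ (A * D * B) i j := by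
    intro i j
    rw [Matrix.mul_apply, Finset.mul_sum]
    refine Finset.sum_le_sum fun l _ => Nat.mul_le_mul_right _ ?_
    rw [Matrix.mul_apply]
    exact Finset.sum_le_sum fun k _ => Nat.le_mul_of_pos_right _ (hD k l)
  calc entrySum A * entrySum B = ∑ i, ∑ j, (∑ k, A i k) * (∑ l, B l j) := by
        rw [entrySum, entrySum, Finset.sum_comm (f := fun i j => B i j), Finset.sum_mul_sum]
    _ ≤ _ := Finset.sum_le_sum fun i _ => Finset.sum_le_sum fun j _ => e i j

/-- If a factor `D` without zero entries occurs after `B`, some diagonal entry of the product is at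
least the average column sum of `B`. -/
lemma exists_entrySum_le_diag [NeZero r] (t s t' : List (Nielsen r)) (h : ∀ θ, θ ∈ s) :
    ∃ i, entrySum (seqMatrix t) ≤ r * seqMatrix (t ++ s ++ t') i i := by
  obtain ⟨i, -, hi⟩ := Finset.exists_max_image (Finset.univ : Finset (Fin r))
    (fun i => ∑ l, seqMatrix t l i) ⟨0, Finset.mem_univ _⟩
  refine ⟨i, ?_⟩
  calc entrySum (seqMatrix t) = ∑ j, ∑ l, seqMatrix t l j := Finset.sum_comm
    _ ≤ ∑ _j : Fin r, ∑ l, seqMatrix t l i := Finset.sum_le_sum fun j hj => hi j hj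
    _ = r * ∑ l, seqMatrix t l i := by simp
    _ ≤ _ := by
      refine Nat.mul_le_mul_left _ ?_
      rw [seqMatrix_append, seqMatrix_append]
      refine le_trans ?_ (le_seqMatrix_mul_left _ _ i i)
      rw [Matrix.mul_apply]
      exact Finset.sum_le_sum fun l _ => Nat.le_mul_of_pos_left _ (seqMatrix_pos s h i l)

end TrainTrackWalk

namespace TrainTrackWalk

variable {r : ℕ}

/-! ### The spectral radius and the operator norm against the entries -/

lemma diag_pow_le (A : Matrix (Fin r) (Fin r) ℕ) (i : Fin r) (k : ℕ) :
    A i i ^ k ≤ (A ^ k) i i := by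
  induction k with
  | zero => simp
  | succ k ih =>
    rw [pow_succ, pow_succ, Matrix.mul_apply]
    exact (Nat.mul_le_mul_right _ ih).trans
      (Finset.single_le_sum (f := fun j => (A ^ k) i j * A j i) (fun _ _ => Nat.zero_le _)
        (Finset.mem_univ i))

open scoped Matrix.Norms.Operator in
lemma RoseMap.specRadius_le_entrySum [NeZero r] (f : RoseMap r) :
    f.specRadius ≤ (entrySum f.transitionMatrix : ℕ) := by
  have : CompleteSpace (Matrix (Fin r) (Fin r) ℂ) := FiniteDimensional.complete ℂ _
  refine (spectrum.spectralRadius_le_nnnorm (𝕜 := ℂ) _).trans ?_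
  rw [← ENNReal.coe_natCast, ENNReal.coe_le_coe, Matrix.linfty_opNNNorm_def]
  refine Finset.sup_le fun i _ => ?_
  simp only [Matrix.map_apply, Complex.nnnorm_natCast]
  rw [← Nat.cast_sum, Nat.cast_le]
  exact Finset.single_le_sum (f := fun i => ∑ j, f.transitionMatrix i j)
    (fun _ _ => Nat.zero_le _) (Finset.mem_univ i)

open scoped Matrix.Norms.Operator in
/-- A diagonal entry of a nonnegative matrix is at most its spectral radius, by Gelfand's
formula. -/
lemma RoseMap.diag_le_specRadius (f : RoseMap r) (i : Fin r) :
    (f.transitionMatrix i i : ℝ≥0∞) ≤ f.specRadius := by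
  have : CompleteSpace (Matrix (Fin r) (Fin r) ℂ) := FiniteDimensional.complete ℂ _
  refine ge_of_tendsto
    (spectrum.pow_nnnorm_pow_one_div_tendsto_nhds_spectralRadius
      (f.transitionMatrix.map (Nat.cast : ℕ → ℂ))) ?_
  filter_upwards [eventually_ne_atTop 0] with k hk
  have h1 : ((f.transitionMatrix ^ k) i i : ℝ≥0∞) ≤
      (‖(f.transitionMatrix.map (Nat.cast : ℕ → ℂ)) ^ k‖₊ : ℝ≥0∞) := by
    rw [← ENNReal.coe_natCast, ENNReal.coe_le_coe]
    have e : (f.transitionMatrix.map (Nat.cast : ℕ → ℂ)) ^ k =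
        (f.transitionMatrix ^ k).map (Nat.cast : ℕ → ℂ) :=
      (Matrix.map_pow f.transitionMatrix (Nat.castRingHom ℂ) k).symm
    rw [e, Matrix.linfty_opNNNorm_def]
    refine le_trans ?_ (Finset.le_sup (Finset.mem_univ i))
    refine le_trans ?_ (Finset.single_le_sum (fun _ _ => zero_le) (Finset.mem_univ i))
    simp
  calc (f.transitionMatrix i i : ℝ≥0∞)
      = ((f.transitionMatrix i i : ℝ≥0∞) ^ k) ^ (1 / k : ℝ) := by
        rw [one_div, ENNReal.pow_rpow_inv_natCast hk]
    _ ≤ _ := by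
      refine ENNReal.rpow_le_rpow (le_trans ?_ h1) (by positivity)
      exact_mod_cast diag_pow_le f.transitionMatrix i k

lemma RoseMap.matrixNorm_le_entrySum (f : RoseMap r) :
    f.matrixNorm ≤ entrySum f.transitionMatrix := by
  refine ContinuousLinearMap.opNorm_le_bound _ (Nat.cast_nonneg _) fun v => ?_
  have hv : ∀ j, ‖v j‖ ≤ ‖v‖ := fun j => PiLp.norm_apply_le v j
  set A := f.transitionMatrix.map (Nat.cast : ℕ → ℝ) with hA
  have h1 : ‖Matrix.toEuclideanCLM (n := Fin r) (𝕜 := ℝ) A v‖ ≤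
      ∑ i, ‖(Matrix.toEuclideanCLM (n := Fin r) (𝕜 := ℝ) A v) i‖ := by
    rw [EuclideanSpace.norm_eq]
    refine Real.sqrt_le_iff.2 ⟨Finset.sum_nonneg fun _ _ => norm_nonneg _, ?_⟩
    exact Finset.sum_sq_le_sq_sum_of_nonneg fun _ _ => norm_nonneg _
  refine h1.trans ?_
  rw [entrySum, Nat.cast_sum, Finset.sum_mul]
  refine Finset.sum_le_sum fun i _ => ?_
  rw [Matrix.ofLp_toEuclideanCLM, Matrix.mulVec, dotProduct, Nat.cast_sum, Finset.sum_mul]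
  refine (norm_sum_le _ _).trans (Finset.sum_le_sum fun j _ => ?_)
  rw [norm_mul]
  simp only [hA, Matrix.map_apply, Real.norm_natCast]
  exact mul_le_mul_of_nonneg_left (hv j) (Nat.cast_nonneg _)

lemma RoseMap.entrySum_le_matrixNorm (f : RoseMap r) :
    (entrySum f.transitionMatrix : ℝ) ≤ r ^ 2 * f.matrixNorm := by
  have h : ∀ i j, (f.transitionMatrix i j : ℝ) ≤ f.matrixNorm := by
    intro i j
    have h1 := ContinuousLinearMap.le_opNorm (Matrix.toEuclideanCLM (n := Fin r) (𝕜 := ℝ)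
      (f.transitionMatrix.map (Nat.cast : ℕ → ℝ))) (EuclideanSpace.single j 1)
    rw [PiLp.norm_single, norm_one, mul_one] at h1
    refine le_trans ?_ h1
    refine le_trans ?_ (PiLp.norm_apply_le _ i)
    rw [Matrix.ofLp_toEuclideanCLM]
    simp
  calc (entrySum f.transitionMatrix : ℝ) = ∑ i, ∑ j, (f.transitionMatrix i j : ℝ) := by
        simp [entrySum]
    _ ≤ ∑ _i : Fin r, ∑ _j : Fin r, f.matrixNorm := by
        gcongr with i _ j _
        exact h i j
    _ = _ := by simp; ring

/-! ### Absence of cancellation along admissible sequences -/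

/-- The path that crosses `a` and then `b` is reduced and takes the turn `{a⁻¹, b}`, which is
required here to be different from the only illegal turn `{x, y}` of `[x ↦ yx]`. -/
def LegalTurn (θ : Nielsen r) (a b : Letter r) : Prop :=
  b ≠ a.inv ∧ ¬ (a.inv = θ.x ∧ b = θ.y) ∧ ¬ (a.inv = θ.y ∧ b = θ.x)

/-- The direction map of `[x ↦ yx]`: the first edge of the image of an oriented edge. -/
def Nielsen.direction (θ : Nielsen r) (z : Letter r) : Letter r := if z = θ.x then θ.y else z

lemma Nielsen.y_ne_x (θ : Nielsen r) : θ.y ≠ θ.x := fun h => θ.fst_ne (congrArg Prod.fst h)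

lemma Nielsen.direction_ne_x (θ : Nielsen r) (z : Letter r) : θ.direction z ≠ θ.x := by
  unfold Nielsen.direction
  split_ifs with h
  · exact θ.y_ne_x
  · exact h

lemma Nielsen.head?_edgePath (θ : Nielsen r) (z : Letter r) :
    (θ.roseMap.edgePath z).head? = some (θ.direction z) := by
  unfold Nielsen.direction
  by_cases h : z = θ.x
  · rw [if_pos h, h, edgePath_x]; rfl
  · rw [if_neg h]
    by_cases h' : z = θ.x.inv
    · rw [h', edgePath_inv_x]; rfl
    · rw [edgePath_of_ne _ _ h h']; rfl

lemma Nielsen.getLast?_edgePath (θ : Nielsen r) (z : Letter r) :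
    (θ.roseMap.edgePath z).getLast? = some (θ.direction z.inv).inv := by
  have h := θ.head?_edgePath z.inv
  rw [RoseMap.edgePath_inv, FreeGroup.invRev, List.head?_reverse, List.getLast?_map] at h
  obtain ⟨a, ha, ha'⟩ := Option.map_eq_some_iff.1 h
  rw [ha, ← ha']
  simp [Letter.inv]

/-- A legal turn of `[x ↦ yx]` is mapped to a legal turn of every admissible successor, since the
illegal turn of the successor contains the direction `x`, which is not an image. -/
lemma LegalTurn.image {θ θ' : Nielsen r} (hθ : Nielsen.Admissible θ θ') {a b : Letter r}
    (h : LegalTurn θ a b) : LegalTurn θ' (θ.direction a.inv).inv (θ.direction b) := by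
  obtain ⟨h1, h2, h3⟩ := h
  have ha := θ.direction_ne_x a.inv
  have hb := θ.direction_ne_x b
  have hx : θ'.x = θ.x ∨ θ'.y = θ.x := hθ.imp And.left And.left
  rw [LegalTurn, Letter.inv_inv]
  refine ⟨?_, ?_, ?_⟩
  · unfold Nielsen.direction
    split_ifs with e1 e2 e2
    · exact absurd (e1.trans e2.symm) h1
    · exact fun e => h3 ⟨e.symm, e1⟩
    · exact fun e => h2 ⟨e2, e⟩
    · exact h1
  · rintro ⟨e1, e2⟩
    rcases hx with hx | hx
    · exact ha (e1.trans hx)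
    · exact hb (e2.trans hx)
  · rintro ⟨e1, e2⟩
    rcases hx with hx | hx
    · exact hb (e2.trans hx)
    · exact ha (e1.trans hx)

/-- The turns inside the image of a single edge are legal for every admissible successor. -/
lemma isChain_edgePath {θ θ' : Nielsen r} (hθ : Nielsen.Admissible θ θ') (z : Letter r) :
    (θ.roseMap.edgePath z).IsChain (LegalTurn θ') := by
  have hyx := θ.inv_y_ne_x
  by_cases h : z = θ.x
  · rw [h, Nielsen.edgePath_x, List.isChain_pair]
    refine ⟨hyx.symm, ?_, ?_⟩
    · rintro ⟨e1, e2⟩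
      rcases hθ with ⟨h1, _⟩ | ⟨_, h2⟩
      · exact hyx (e1.trans h1)
      · exact h2 e1.symm
    · rintro ⟨e1, e2⟩
      rcases hθ with ⟨_, h2⟩ | ⟨h1, _⟩
      · exact h2 e1.symm
      · exact hyx (e1.trans h1)
  · by_cases h' : z = θ.x.inv
    · rw [h', Nielsen.edgePath_inv_x, List.isChain_pair, LegalTurn, Letter.inv_inv]
      refine ⟨hyx, ?_, ?_⟩
      · rintro ⟨e1, e2⟩
        rcases hθ with ⟨_, h2⟩ | ⟨h1, _⟩
        · exact h2 e2.symm
        · exact hyx (e2.trans h1)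
      · rintro ⟨e1, e2⟩
        rcases hθ with ⟨h1, _⟩ | ⟨_, h2⟩
        · exact hyx (e2.trans h1)
        · exact h2 e2.symm
    · rw [Nielsen.edgePath_of_ne _ _ h h']
      exact List.isChain_singleton _

/-- A cyclic word, given by a list, that is cyclically reduced and does not take the illegal turn
of `[x ↦ yx]`. -/
structure LegalLoop (θ : Nielsen r) (w : List (Letter r)) : Prop where
  ne_nil : w ≠ []
  chain : w.IsChain (LegalTurn θ)
  wrap : ∀ a ∈ w.getLast?, ∀ b ∈ w.head?, LegalTurn θ a b

lemma LegalLoop.image {θ θ' : Nielsen r} (hθ : Nielsen.Admissible θ θ') {w : List (Letter r)}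
    (h : LegalLoop θ w) : LegalLoop θ' (w.flatMap θ.roseMap.edgePath) where
  ne_nil := by
    obtain ⟨e, he⟩ := List.exists_mem_of_ne_nil _ h.ne_nil
    simp only [ne_eq, List.flatMap_eq_nil_iff, not_forall]
    exact ⟨e, he, RoseMap.edgePath_ne_nil _ e⟩
  chain := by
    rw [List.flatMap_def, List.isChain_flatten]
    · refine ⟨?_, ?_⟩
      · intro l hl
        obtain ⟨z, -, rfl⟩ := List.mem_map.1 hl
        exact isChain_edgePath hθ z
      · rw [List.isChain_map]
        refine h.chain.imp fun a b hab => ?_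
        intro a' ha' b' hb'
        rw [Nielsen.getLast?_edgePath, Option.mem_some_iff] at ha'
        rw [Nielsen.head?_edgePath, Option.mem_some_iff] at hb'
        subst ha' hb'
        exact hab.image hθ
    · intro hn
      obtain ⟨z, -, hz⟩ := List.mem_map.1 hn
      exact RoseMap.edgePath_ne_nil _ _ hz
  wrap := by
    have hw := h.ne_nil
    have e1 : (w.flatMap θ.roseMap.edgePath).head? = some (θ.direction (w.head hw)) := by
      obtain ⟨b, w', rfl⟩ := List.exists_cons_of_ne_nil hw
      rw [List.flatMap_cons, List.head?_append, Nielsen.head?_edgePath]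
      rfl
    have e2 : (w.flatMap θ.roseMap.edgePath).getLast? =
        some (θ.direction (w.getLast hw).inv).inv := by
      obtain ⟨w', a, rfl⟩ := (List.eq_nil_or_concat w).resolve_left hw
      simp [List.getLast?_append, Nielsen.getLast?_edgePath]
    intro a ha b hb
    rw [e2, Option.mem_some_iff] at ha
    rw [e1, Option.mem_some_iff] at hb
    subst ha hb
    exact (h.wrap _ (List.getLast?_eq_getLast_of_ne_nil hw) _ (List.head?_eq_some_head hw)).image hθ

lemma LegalLoop.seq_image (t : List (Nielsen r)) (ht : t ≠ []) (hc : t.IsChain Nielsen.Admissible)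
    {θ' : Nielsen r} (hθ : Nielsen.Admissible (t.getLast ht) θ') {w : List (Letter r)}
    (h : LegalLoop (t.head ht) w) : LegalLoop θ' (w.flatMap (seqRoseMap t).edgePath) := by
  induction t using List.reverseRecOn generalizing θ' with
  | nil => exact absurd rfl ht
  | append_singleton t θ ih =>
    rw [seqRoseMap_concat, RoseMap.flatMap_comp]
    rw [List.getLast_concat] at hθ
    by_cases ht' : t = []
    · subst ht'
      have e : w.flatMap (seqRoseMap ([] : List (Nielsen r))).edgePath = w := RoseMap.edgePath_id w
      rw [e]
      exact h.image hθ
    · rw [List.isChain_append] at hc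
      refine (ih ht' hc.1 ?_ ?_).image hθ
      · exact hc.2.2 _ (List.getLast?_eq_getLast_of_ne_nil ht') _ rfl
      · rwa [List.head_append_of_ne_nil ht'] at h

lemma LegalLoop.iterate {t : List (Nielsen r)} (ht : CyclicallyAdmissible t) {w : List (Letter r)}
    (h : LegalLoop (t.head ht.choose) w) (k : ℕ) :
    LegalLoop (t.head ht.choose) ((fun w => w.flatMap (seqRoseMap t).edgePath)^[k] w) := by
  induction k with
  | zero => exact h
  | succ k ih =>
    rw [Function.iterate_succ_apply']
    exact ih.seq_image t _ ht.choose_spec.1 ht.choose_spec.2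

lemma LegalLoop.singleton (θ : Nielsen r) (z : Letter r) : LegalLoop θ [z] where
  ne_nil := by simp
  chain := List.isChain_singleton _
  wrap := by
    intro a ha b hb
    simp only [List.getLast?_singleton, List.head?_cons, Option.mem_some_iff] at ha hb
    subst ha hb
    refine ⟨z.inv_ne.symm, ?_, ?_⟩
    · rintro ⟨e1, e2⟩
      exact θ.inv_y_ne_x (e2 ▸ e1)
    · rintro ⟨e1, e2⟩
      exact θ.2.2 (by change θ.y = θ.x.inv; rw [← e1, ← e2])

lemma LegalLoop.isCyclicallyReduced {θ : Nielsen r} {w : List (Letter r)} (h : LegalLoop θ w) :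
    FreeGroup.IsCyclicallyReduced w := by
  have key : ∀ a b, LegalTurn θ a b → a.1 = b.1 → a.2 = b.2 := by
    rintro ⟨i, b⟩ ⟨j, c⟩ ⟨h1, -⟩ e
    simp only at e
    subst e
    by_contra hne
    exact h1 (by cases b <;> cases c <;> simp_all [Letter.inv])
  exact ⟨h.chain.imp key, fun a ha b hb => key a b (h.wrap a ha b hb)⟩

lemma cycLenAux_mk {w : List (Letter r)} (h : FreeGroup.IsCyclicallyReduced w) :
    cycLenAux (FreeGroup.mk w : F r) = w.length := by
  rw [cycLenAux, FreeGroup.toWord_mk, h.isReduced.reduce_eq]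
  induction w using List.bidirectionalRec with
  | nil => simp
  | singleton => simp
  | cons_append a l b _ =>
    rw [FreeGroup.reduceCyclically.cons_append, if_neg]
    · simp
    · rintro ⟨e1, e2⟩
      have := (FreeGroup.isCyclicallyReduced_cons_append_iff.1 h).2 e1
      rw [this] at e2
      simp at e2

/-! ### Stretch factors -/

lemma apply_mk_of_path {f : RoseMap r} {Φ : MulAut (F r)}
    (h : ∀ i, Φ (FreeGroup.of i) = FreeGroup.mk (f.path i)) (w : List (Letter r)) :
    Φ (FreeGroup.mk w) = FreeGroup.mk (w.flatMap f.edgePath) := by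
  induction w with
  | nil => exact map_one _
  | cons e w ih =>
    have : (FreeGroup.mk (e :: w) : F r) = Letter.toF e * FreeGroup.mk w := by
      simp [Letter.toF, FreeGroup.mul_mk]
    rw [this, map_mul, ih, List.flatMap_cons, ← FreeGroup.mul_mk]
    congr 1
    obtain ⟨k, b⟩ := e
    cases b
    · simp [Letter.toF_false, RoseMap.edgePath, h, ← FreeGroup.inv_mk]
    · simp [Letter.toF_true, RoseMap.edgePath, h]

lemma pow_apply_mk_of_path {f : RoseMap r} {Φ : MulAut (F r)}
    (h : ∀ i, Φ (FreeGroup.of i) = FreeGroup.mk (f.path i)) (w : List (Letter r)) (k : ℕ) :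
    (Φ ^ k) (FreeGroup.mk w) = FreeGroup.mk ((fun w => w.flatMap f.edgePath)^[k] w) := by
  induction k with
  | zero => rfl
  | succ k ih =>
    rw [pow_succ', MulAut.mul_apply, ih, apply_mk_of_path h, Function.iterate_succ_apply']

lemma cycLen_act_pow (Φ : MulAut (F r)) (k : ℕ) (w : F r) :
    cycLen (Out.act ((QuotientGroup.mk Φ : Out r) ^ k) (ConjClasses.mk w)) =
      cycLenAux ((Φ ^ k) w) := rfl

lemma cycLenAux_le_norm (w : F r) : cycLenAux w ≤ w.norm := by
  have := norm_pow_eq w 1 one_ne_zero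
  rw [pow_one] at this
  omega

lemma RoseMap.length_flatMap_le (f : RoseMap r) (w : List (Letter r)) :
    (w.flatMap f.edgePath).length ≤ entrySum f.transitionMatrix * w.length := by
  induction w with
  | nil => simp
  | cons e w ih =>
    rw [List.flatMap_cons, List.length_append, List.length_cons, mul_add, mul_one, add_comm]
    refine add_le_add ih ?_
    rw [length_eq_sum_countP, entrySum]
    refine Finset.sum_le_sum fun i _ => ?_
    rw [RoseMap.countP_edgePath]
    exact Finset.single_le_sum (f := fun j => f.transitionMatrix i j) (fun _ _ => Nat.zero_le _)
      (Finset.mem_univ e.1)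

lemma RoseMap.length_iterate_le (f : RoseMap r) (w : List (Letter r)) (k : ℕ) :
    ((fun w => w.flatMap f.edgePath)^[k] w).length ≤
      entrySum f.transitionMatrix ^ k * w.length := by
  induction k with
  | zero => simp
  | succ k ih =>
    rw [Function.iterate_succ_apply', pow_succ', mul_assoc]
    exact (f.length_flatMap_le _).trans (Nat.mul_le_mul_left _ ih)

lemma RoseMap.countP_iterate (f : RoseMap r) (i j : Fin r) (k : ℕ) :
    ((fun w => w.flatMap f.edgePath)^[k] [(j, true)]).countP (fun z => z.1 = i) =
      (f.transitionMatrix ^ k) i j := by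
  induction k generalizing i with
  | zero => simp [List.countP_cons, Matrix.one_apply, eq_comm]
  | succ k ih =>
    rw [Function.iterate_succ_apply', RoseMap.countP_flatMap_edgePath, pow_succ', Matrix.mul_apply]
    simp only [ih]

lemma RoseMap.Represents.stretch_le {f : RoseMap r} {φ : Out r} (h : f.Represents φ) :
    stretch φ ≤ (entrySum f.transitionMatrix : ℕ) := by
  obtain ⟨Φ, hΦ, rfl⟩ := h
  refine iSup_le fun w => ?_
  set K := entrySum f.transitionMatrix
  set l := w.1.toWord.length + 1
  have hlim : Tendsto (fun n : ℕ => (K : ℝ≥0∞) * (l : ℝ≥0∞) ^ (1 / (n : ℝ))) atTop (𝓝 K) := by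
    have h1 : Tendsto (fun n : ℕ => (l : ℝ≥0∞) ^ (1 / (n : ℝ))) atTop (𝓝 1) := by
      have h2 : Tendsto (fun n : ℕ => ((l : ℝ) ^ (1 / (n : ℝ)))) atTop (𝓝 ((l : ℝ) ^ (0 : ℝ))) :=
        (Real.continuousAt_const_rpow (by positivity)).tendsto.comp
          tendsto_one_div_atTop_nhds_zero_nat
      rw [Real.rpow_zero] at h2
      have h3 := ENNReal.tendsto_ofReal h2
      rw [ENNReal.ofReal_one] at h3
      refine h3.congr fun n => ?_
      rw [← ENNReal.ofReal_rpow_of_pos (by positivity), ENNReal.ofReal_natCast]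
    simpa using ENNReal.Tendsto.const_mul h1 (Or.inr (ENNReal.natCast_ne_top K))
  rw [stretchAt, ← hlim.limsup_eq]
  refine limsup_le_limsup ?_
  filter_upwards [eventually_ne_atTop 0] with k hk
  have hb : cycLenAux ((Φ ^ k) w.1) ≤ K ^ k * l := by
    refine (cycLenAux_le_norm _).trans ?_
    rw [← FreeGroup.mk_toWord (x := w.1), pow_apply_mk_of_path hΦ]
    refine FreeGroup.norm_mk_le.trans ((f.length_iterate_le _ k).trans ?_)
    exact Nat.mul_le_mul_left _ (Nat.le_succ _)
  rw [cycLen_act_pow]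
  calc ((cycLenAux ((Φ ^ k) w.1) : ℕ) : ℝ≥0∞) ^ (1 / (k : ℝ))
      ≤ ((K : ℝ≥0∞) ^ k * l) ^ (1 / (k : ℝ)) :=
        ENNReal.rpow_le_rpow (by exact_mod_cast hb) (by positivity)
    _ = K * (l : ℝ≥0∞) ^ (1 / (k : ℝ)) := by
        rw [ENNReal.mul_rpow_of_nonneg _ _ (by positivity), one_div,
          ENNReal.pow_rpow_inv_natCast hk]

/-- For a cyclically admissible `𝔱`, the loop `a_i` is legal for all powers of `g_𝔱`, so that its
images are cyclically reduced and their lengths are column sums of powers of `M(g_𝔱)`. -/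
lemma diag_le_stretch {t : List (Nielsen r)} (ht : CyclicallyAdmissible t) (i : Fin r) :
    (seqMatrix t i i : ℝ≥0∞) ≤ stretch (seqOut t) := by
  obtain ⟨Φ, hΦ, hφ⟩ := seqRoseMap_represents t
  rw [← hφ]
  refine le_trans ?_ (le_iSup (fun w : {w : F r // w ≠ 1} => stretchAt _ w.1)
    ⟨FreeGroup.of i, FreeGroup.of_ne_one i⟩)
  refine le_trans (le_liminf_of_le (by isBoundedDefault) ?_) (liminf_le_limsup)
  filter_upwards [eventually_ne_atTop 0] with k hk
  have hb : seqMatrix t i i ^ k ≤ cycLenAux ((Φ ^ k) (FreeGroup.of i)) := by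
    have e : (FreeGroup.of i : F r) = FreeGroup.mk [(i, true)] := rfl
    rw [e, pow_apply_mk_of_path hΦ, cycLenAux_mk
      ((LegalLoop.singleton _ _).iterate ht k).isCyclicallyReduced,
      RoseMap.length_eq_sum_countP]
    refine (diag_pow_le _ i k).trans ?_
    simp only [RoseMap.countP_iterate]
    exact Finset.single_le_sum (f := fun j => ((seqRoseMap t).transitionMatrix ^ k) j i)
      (fun _ _ => Nat.zero_le _) (Finset.mem_univ i)
  rw [cycLen_act_pow]
  calc (seqMatrix t i i : ℝ≥0∞) = ((seqMatrix t i i : ℝ≥0∞) ^ k) ^ (1 / (k : ℝ)) := by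
        rw [one_div, ENNReal.pow_rpow_inv_natCast hk]
    _ ≤ _ := ENNReal.rpow_le_rpow (by exact_mod_cast hb) (by positivity)

end TrainTrackWalk

namespace TrainTrackWalk

variable {r : ℕ}

/-! ### The walk driven by independent random maps -/

lemma Nielsen.admissible_self (θ : Nielsen r) : Nielsen.Admissible θ θ :=
  Or.inl ⟨rfl, θ.y.inv_ne.symm⟩

/-- A choice of an admissible successor of every state. -/
abbrev Selection (r : ℕ) : Type :=
  (θ : Nielsen r) → {θ' : Nielsen r // Nielsen.Admissible θ θ'}

instance (θ : Nielsen r) : Nonempty {θ' : Nielsen r // Nielsen.Admissible θ θ'} :=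
  ⟨⟨θ, θ.admissible_self⟩⟩

instance (θ : Nielsen r) :
    IsProbabilityMeasure (uniformOn (Set.univ : Set {θ' : Nielsen r // Nielsen.Admissible θ θ'})) :=
  isProbabilityMeasure_uniformOn Set.finite_univ Set.univ_nonempty

/-- The law of a random selection: the successors of the different states are independent and
uniform among the admissible ones. -/
noncomputable def selectionMeasure (r : ℕ) : Measure (Selection r) :=
  Measure.pi fun _ => uniformOn Set.univ

instance : IsProbabilityMeasure (selectionMeasure r) := by
  unfold selectionMeasure
  infer_instance

/-- The law of a sequence of independent random selections. -/
noncomputable def drivingMeasure (r : ℕ) : Measure (ℕ → Selection r) :=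
  Measure.infinitePi fun _ => selectionMeasure r

instance : IsProbabilityMeasure (drivingMeasure r) := by
  unfold drivingMeasure
  infer_instance

/-- The trajectory that starts at `s` and follows the selections `U 0, U 1, …`. -/
def walk (s : Nielsen r) (U : ℕ → Selection r) : ℕ → Nielsen r
  | 0 => s
  | n + 1 => (U n (walk s U n)).1

lemma selectionMeasure_eval (θ θ' : Nielsen r) :
    selectionMeasure r {u | (u θ).1 = θ'} = transProb θ θ' := by
  have h := (measurePreserving_eval (fun θ : Nielsen r =>
    uniformOn (Set.univ : Set {θ' : Nielsen r // Nielsen.Admissible θ θ'})) θ).measure_preimage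
    (s := {η | η.1 = θ'}) MeasurableSet.of_discrete.nullMeasurableSet
  have h' : selectionMeasure r {u | (u θ).1 = θ'} = uniformOn
    (Set.univ : Set {θ' : Nielsen r // Nielsen.Admissible θ θ'}) {η | η.1 = θ'} := h
  rw [h', transProb]
  split_ifs with hA
  · have hs : {η : {θ' : Nielsen r // Nielsen.Admissible θ θ'} | η.1 = θ'} = {⟨θ', hA⟩} := by
      ext η; simp [Subtype.ext_iff]
    rw [hs, uniformOn_univ, Measure.count_singleton, Fintype.card_subtype, card_admissible, one_div]
  · have hs : {η : {θ' : Nielsen r // Nielsen.Admissible θ θ'} | η.1 = θ'} = ∅ := by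
      ext η
      simp only [Set.mem_ofPred_eq, Set.mem_empty_iff_false, iff_false]
      rintro rfl
      exact hA η.2
    rw [hs, measure_empty]

lemma selectionMeasure_singleton_pos (u : Selection r) : 0 < selectionMeasure r {u} := by
  rw [selectionMeasure, Measure.pi_singleton]
  refine CanonicallyOrderedAdd.prod_pos.2 fun θ _ => ?_
  rw [uniformOn_univ, Measure.count_singleton]
  exact ENNReal.div_pos one_ne_zero (ENNReal.natCast_ne_top _)

lemma measurable_walk (s : Nielsen r) : Measurable (walk s) := by
  refine measurable_pi_iff.2 fun n => ?_
  induction n with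
  | zero => exact measurable_const
  | succ n ih =>
    have h1 : Measurable fun U : ℕ → Selection r => (U n, walk s U n) :=
      (measurable_pi_apply n).prodMk ih
    have h2 : Measurable fun p : Selection r × Nielsen r => (p.1 p.2).1 :=
      Measurable.of_discrete
    exact h2.comp h1

lemma walk_cylinder (s : Nielsen r) (σ : ℕ → Nielsen r) (n : ℕ) :
    drivingMeasure r {U | ∀ i ≤ n, walk s U i = σ i} =
      if s = σ 0 then ∏ i ∈ Finset.range n, transProb (σ i) (σ (i + 1)) else 0 := by
  split_ifs with h
  · have hs : {U : ℕ → Selection r | ∀ i ≤ n, walk s U i = σ i} =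
        Set.pi (Finset.range n) fun i => {u | (u (σ i)).1 = σ (i + 1)} := by
      ext U
      simp only [Set.mem_ofPred_eq, Set.mem_pi, Finset.coe_range, Set.mem_Iio]
      constructor
      · intro hU i hi
        rw [← hU i hi.le, ← hU (i + 1) hi]
        rfl
      · intro hU i
        induction i with
        | zero => exact fun _ => h
        | succ i ih =>
          intro hi
          rw [← hU i hi, ← ih (Nat.le_of_succ_le hi)]
          rfl
    rw [hs, drivingMeasure, Measure.infinitePi_pi _ fun _ _ => MeasurableSet.of_discrete]
    exact Finset.prod_congr rfl fun i _ => selectionMeasure_eval _ _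
  · have hs : {U : ℕ → Selection r | ∀ i ≤ n, walk s U i = σ i} = ∅ := by
      ext U
      simp only [Set.mem_ofPred_eq, Set.mem_empty_iff_false, iff_false]
      exact fun hU => h (hU 0 (Nat.zero_le _))
    rw [hs, measure_empty]

/-- The law of the walk is the average, over the initial state, of the laws of the trajectories
driven by independent random selections. -/
lemma walkMeasure_eq (hr : 3 ≤ r) :
    walkMeasure r = ∑ s : Nielsen r,
      (Fintype.card (Nielsen r) : ℝ≥0∞)⁻¹ • (drivingMeasure r).map (walk s) := by
  have hne : Nonempty (Nielsen r) :=
    ⟨⟨((⟨0, by omega⟩, true), (⟨1, by omega⟩, true)), by simp [Letter.inv]⟩⟩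
  have : IsProbabilityMeasure (uniformOn (Set.univ : Set (Nielsen r))) :=
    isProbabilityMeasure_uniformOn Set.finite_univ Set.univ_nonempty
  have hprob : IsProbabilityMeasure (walkMeasure r) := by
    unfold walkMeasure
    infer_instance
  set P : (I : Finset ℕ) → Measure (Π _ : I, Nielsen r) :=
    fun I => (walkMeasure r).map I.restrict with hP
  have hfam : IsProjectiveMeasureFamily (α := fun _ : ℕ => Nielsen r) P := by
    intro I J hJI
    rw [hP]
    simp only
    rw [Measure.map_map (by fun_prop) (by fun_prop)]
    rfl
  have h1 : IsProjectiveLimit (α := fun _ : ℕ => Nielsen r) (walkMeasure r) P := fun I => rfl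
  have hfin : ∀ I, IsFiniteMeasure (P I) := fun I => by rw [hP]; infer_instance
  refine h1.unique ((isProjectiveLimit_nat_iff hfam _).2 fun n => ?_)
  refine Measure.ext_of_singleton fun h => ?_
  set σ : ℕ → Nielsen r := fun i =>
    if hi : i ≤ n then h ⟨i, Finset.mem_Iic.2 hi⟩ else Classical.arbitrary _ with hσ
  have hset : Preorder.frestrictLe (π := fun _ : ℕ => Nielsen r) n ⁻¹' {h} =
      {ω | ∀ i ≤ n, ω i = σ i} := by
    ext ω
    constructor
    · rintro rfl i hi
      simp [hσ, hi]
    · intro hω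
      funext ⟨i, hi⟩
      have hi' := Finset.mem_Iic.1 hi
      change ω i = _
      rw [hω i hi']
      simp [hσ, hi']
  have hmeas : MeasurableSet (Preorder.frestrictLe (π := fun _ : ℕ => Nielsen r) n ⁻¹' {h}) :=
    (by fun_prop : Measurable (Preorder.frestrictLe (π := fun _ : ℕ => Nielsen r) n))
      MeasurableSet.of_discrete
  have hL : (Measure.map (Preorder.frestrictLe n) (∑ s : Nielsen r,
      (Fintype.card (Nielsen r) : ℝ≥0∞)⁻¹ • (drivingMeasure r).map (walk s))) {h} =
      (Fintype.card (Nielsen r) : ℝ≥0∞)⁻¹ *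
        ∏ i ∈ Finset.range n, transProb (σ i) (σ (i + 1)) := by
    rw [Measure.map_apply (by fun_prop) MeasurableSet.of_discrete, Measure.finsetSum_apply]
    simp only [Measure.smul_apply, smul_eq_mul]
    rw [← Finset.mul_sum]
    congr 1
    have : ∀ s, (drivingMeasure r).map (walk s) (Preorder.frestrictLe n ⁻¹' {h}) =
        if s = σ 0 then ∏ i ∈ Finset.range n, transProb (σ i) (σ (i + 1)) else 0 := by
      intro s
      rw [Measure.map_apply (measurable_walk s) hmeas, hset]
      exact walk_cylinder s σ n
    simp [this]
  have hR : P (Finset.Iic n) {h} = (Fintype.card (Nielsen r) : ℝ≥0∞)⁻¹ *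
        ∏ i ∈ Finset.range n, transProb (σ i) (σ (i + 1)) := by
    rw [← walkMeasure_cylinder hr, ← hset]
    exact Measure.map_apply (by fun_prop) MeasurableSet.of_discrete
  rw [hL, hR]

lemma ae_walkMeasure (hr : 3 ≤ r) {Q : (ℕ → Nielsen r) → Prop} (hQ : MeasurableSet {ω | Q ω})
    (h : ∀ s, ∀ᵐ U ∂drivingMeasure r, Q (walk s U)) : ∀ᵐ ω ∂walkMeasure r, Q ω := by
  rw [ae_iff, walkMeasure_eq hr, Measure.finsetSum_apply]
  refine Finset.sum_eq_zero fun s _ => ?_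
  have hc : MeasurableSet {ω | ¬ Q ω} := hQ.compl
  rw [Measure.smul_apply, Measure.map_apply (measurable_walk s) hc]
  have : drivingMeasure r (walk s ⁻¹' {ω | ¬ Q ω}) = 0 := ae_iff.1 (h s)
  rw [this, smul_zero]

/-- Functions of an initial segment are measurable. -/
lemma measurable_initialSegment {β : Type*} [MeasurableSpace β] (f : List (Nielsen r) → β) (n : ℕ) :
    Measurable fun ω : ℕ → Nielsen r => f (initialSegment ω n) := by
  have h1 : Measurable fun (ω : ℕ → Nielsen r) (i : Fin n) => ω i := by fun_prop
  have h2 : Measurable fun v : Fin n → Nielsen r => f (List.ofFn v) := Measurable.of_discrete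
  have e : (fun ω : ℕ → Nielsen r => f (initialSegment ω n)) =
      (fun v : Fin n → Nielsen r => f (List.ofFn v)) ∘
        fun (ω : ℕ → Nielsen r) (i : Fin n) => ω i := by
    funext ω
    simp only [Function.comp_apply, initialSegment]
    congr 1
    exact List.ext_getElem (by simp) (by simp)
  rw [e]
  exact h2.comp h1

/-! ### Blocks of selections and the law of large numbers -/

/-- The `j`-th block of `L` consecutive selections. -/
def block (L : ℕ) (U : ℕ → Selection r) (j : ℕ) : List (Selection r) :=
  List.ofFn fun i : Fin L => U (j * L + i)

lemma length_block (L : ℕ) (U : ℕ → Selection r) (j : ℕ) : (block L U j).length = L := by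
  simp [block]

lemma map_range_succ_mul (L : ℕ) (U : ℕ → Selection r) (k : ℕ) :
    (List.range ((k + 1) * L)).map U = (List.range (k * L)).map U ++ block L U k := by
  rw [Nat.succ_mul, List.range_add, List.map_append, List.map_map]
  congr 1
  exact List.ext_getElem (by simp [block]) (by simp [block])

lemma measurable_block {β : Type*} [MeasurableSpace β] (L : ℕ) (f : List (Selection r) → β)
    (j : ℕ) : Measurable fun U : ℕ → Selection r => f (block L U j) := by
  have h1 : Measurable fun (U : ℕ → Selection r) (i : Fin L) => U (j * L + i) := by fun_prop
  have h2 : Measurable fun v : Fin L → Selection r => f (List.ofFn v) := Measurable.of_discrete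
  exact h2.comp h1

lemma integrable_block (L : ℕ) (f : List (Selection r) → ℝ) (j : ℕ) :
    Integrable (fun U => f (block L U j)) (drivingMeasure r) := by
  obtain ⟨C, hC⟩ := (Set.finite_range fun v : Fin L → Selection r => ‖f (List.ofFn v)‖).bddAbove
  refine Integrable.of_bound (C := C) (measurable_block L f j).aestronglyMeasurable ?_
  exact Eventually.of_forall fun U => hC ⟨fun i => U (j * L + i), rfl⟩

lemma iIndepFun_eval : iIndepFun (fun (i : ℕ) (U : ℕ → Selection r) => U i) (drivingMeasure r) :=
  iIndepFun_infinitePi (P := fun _ => selectionMeasure r) (X := fun _ u => u)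
    fun _ => measurable_id

lemma block_law_of_large_numbers (L : ℕ) (f : List (Selection r) → ℝ) :
    ∀ᵐ U ∂drivingMeasure r,
      Tendsto (fun k : ℕ => (∑ j ∈ Finset.range k, f (block L U j)) / k) atTop
        (𝓝 (∫ U, f (block L U 0) ∂drivingMeasure r)) := by
  refine strong_law_ae_real (fun j U => f (block L U j)) (integrable_block L f 0) ?_ ?_
  · intro j j' hj
    have hdisj : Disjoint (Finset.Ico (j * L) (j * L + L)) (Finset.Ico (j' * L) (j' * L + L)) := by
      rw [Finset.disjoint_left]
      intro a ha ha'
      rw [Finset.mem_Ico] at ha ha'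
      have h1 : a / L = j := Nat.div_eq_of_lt_le ha.1 (by rw [Nat.succ_mul]; exact ha.2)
      have h2 : a / L = j' := Nat.div_eq_of_lt_le ha'.1 (by rw [Nat.succ_mul]; exact ha'.2)
      exact hj (h1.symm.trans h2)
    have hI := iIndepFun_eval.indepFun_finset (μ := drivingMeasure r) _ _ hdisj
      fun _ => by fun_prop
    have hm : ∀ j, Measurable fun h : (Finset.Ico (j * L) (j * L + L) → Selection r) =>
        f (List.ofFn fun i : Fin L => h ⟨j * L + i, Finset.mem_Ico.2 (by omega)⟩) :=
      fun j => Measurable.of_discrete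
    exact hI.comp (hm j) (hm j')
  · intro j
    have hmap : ∀ j, (drivingMeasure r).map (fun U (i : Fin L) => U (j * L + i)) =
        Measure.pi fun _ => selectionMeasure r := by
      intro j
      have hinj : Function.Injective fun i : Fin L => j * L + (i : ℕ) := by
        intro a b hab
        exact Fin.ext (by simpa using hab)
      have h1 := (iIndepFun_iff_map_fun_eq_pi_map (μ := drivingMeasure r)
        (f := fun (i : Fin L) (U : ℕ → Selection r) => U (j * L + i)) fun i => (measurable_pi_apply (j * L + (i : ℕ))).aemeasurable).1
        (iIndepFun_eval (r := r).precomp hinj)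
      rw [h1]
      congr 1
      funext i
      exact Measure.infinitePi_map_eval (fun _ => selectionMeasure r) (j * L + i)
    have hmeas : ∀ j, Measurable fun (U : ℕ → Selection r) (i : Fin L) => U (j * L + i) :=
      fun j => by fun_prop
    have hid : IdentDistrib (fun (U : ℕ → Selection r) (i : Fin L) => U (j * L + i))
        (fun (U : ℕ → Selection r) (i : Fin L) => U (0 * L + i))
        (drivingMeasure r) (drivingMeasure r) :=
      ⟨(hmeas j).aemeasurable, (hmeas 0).aemeasurable, (hmap j).trans (hmap 0).symm⟩
    have hm : Measurable fun v : Fin L → Selection r => f (List.ofFn v) := Measurable.of_discrete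
    exact hid.comp hm

lemma block_zero_eq_pos (G : List (Selection r)) :
    0 < drivingMeasure r {U | block G.length U 0 = G} := by
  set v : ℕ → Set (Selection r) := fun i => if h : i < G.length then {G[i]} else Set.univ with hv
  have hs : {U : ℕ → Selection r | block G.length U 0 = G} =
      Set.pi (Finset.range G.length) v := by
    ext U
    simp only [Set.mem_ofPred_eq, Set.mem_pi, Finset.coe_range, Set.mem_Iio, hv, block]
    constructor
    · intro h i hi
      rw [dif_pos hi, Set.mem_singleton_iff]
      have := List.getElem_of_eq h (i := i) (by simpa using hi)
      simpa using this
    · intro h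
      refine List.ext_getElem (by simp) fun i h1 h2 => ?_
      have := h i h2
      rw [dif_pos h2, Set.mem_singleton_iff] at this
      simpa using this
  rw [hs, drivingMeasure, Measure.infinitePi_pi _ fun _ _ => MeasurableSet.of_discrete]
  refine CanonicallyOrderedAdd.prod_pos.2 fun i hi => ?_
  rw [hv]
  simp only [Finset.mem_range.1 hi, dif_pos]
  exact selectionMeasure_singleton_pos _

end TrainTrackWalk

namespace TrainTrackWalk

variable {r : ℕ}

/-! ### Words of selections and resetting words -/

/-- The states visited from `s` when following a word of selections, the last one excluded. -/
def path (s : Nielsen r) : List (Selection r) → List (Nielsen r)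
  | [] => []
  | u :: v => s :: path (u s).1 v

/-- The state reached from `s` after following a word of selections. -/
def endState (s : Nielsen r) (v : List (Selection r)) : Nielsen r :=
  v.foldl (fun s u => (u s).1) s

lemma endState_append (s : Nielsen r) (v w : List (Selection r)) :
    endState s (v ++ w) = endState (endState s v) w := by
  simp [endState]

lemma path_append (s : Nielsen r) (v w : List (Selection r)) :
    path s (v ++ w) = path s v ++ path (endState s v) w := by
  induction v generalizing s with
  | nil => rfl
  | cons u v ih =>
    rw [List.cons_append, path, path, List.cons_append, ih]
    rfl

lemma length_path (s : Nielsen r) (v : List (Selection r)) : (path s v).length = v.length := by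
  induction v generalizing s with
  | nil => rfl
  | cons u v ih => simp [path, ih]

lemma endState_map_range (s : Nielsen r) (U : ℕ → Selection r) (n : ℕ) :
    endState s ((List.range n).map U) = walk s U n := by
  induction n with
  | zero => rfl
  | succ n ih =>
    rw [List.range_succ, List.map_append, endState_append, ih]
    rfl

lemma initialSegment_walk (s : Nielsen r) (U : ℕ → Selection r) (n : ℕ) :
    initialSegment (walk s U) n = path s ((List.range n).map U) := by
  induction n with
  | zero => rfl
  | succ n ih =>
    rw [initialSegment, List.range_succ, List.map_append, List.map_append, path_append,
      endState_map_range, ← ih]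
    rfl

lemma exists_state (x y : Letter r) (h : x.1 ≠ y.1) : ∃ θ : Nielsen r, θ.x = x ∧ θ.y = y :=
  ⟨⟨(x, y), fun e => h (congrArg Prod.fst e).symm,
    fun e => h (show y.1 = x.inv.1 from congrArg Prod.fst e).symm⟩, rfl, rfl⟩

lemma exists_third (hr : 3 ≤ r) (i j : Fin r) : ∃ k, k ≠ i ∧ k ≠ j := by
  have h : ({i, j} : Finset (Fin r)).card < (Finset.univ : Finset (Fin r)).card := by
    have := Finset.card_le_two (a := i) (b := j)
    simp only [Finset.card_univ, Fintype.card_fin]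
    omega
  obtain ⟨k, -, hk⟩ := Finset.exists_mem_notMem_of_card_lt_card h
  simp only [Finset.mem_insert, Finset.mem_singleton, not_or] at hk
  exact ⟨k, hk⟩

/-- The Markov chain is irreducible. -/
lemma reflTransGen_admissible (hr : 3 ≤ r) (θ θ' : Nielsen r) :
    Relation.ReflTransGen Nielsen.Admissible θ θ' := by
  have hinv : ∀ a b : Letter r, a.1 ≠ b.1 → a ≠ b.inv := fun a b h e =>
    h (show a.1 = b.inv.1 from congrArg Prod.fst e)
  have same : ∀ θ θ' : Nielsen r, θ.x = θ'.x → Relation.ReflTransGen Nielsen.Admissible θ θ' := by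
    intro θ θ' h
    by_cases hy : θ'.y = θ.y.inv
    · obtain ⟨k, hk1, hk2⟩ := exists_third hr θ.x.1 θ.y.1
      obtain ⟨η, hηx, hηy⟩ := exists_state θ.x (k, true) hk1.symm
      have h1 : Nielsen.Admissible θ η := Or.inl ⟨hηx, by rw [hηy]; exact hinv _ _ hk2⟩
      have h2 : Nielsen.Admissible η θ' :=
        Or.inl ⟨h.symm.trans hηx.symm, by rw [hηy, hy]; exact hinv _ _ hk2.symm⟩
      exact (Relation.ReflTransGen.single h1).tail h2
    · exact .single (Or.inl ⟨h.symm, hy⟩)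
  have diff : ∀ θ θ' : Nielsen r, θ.x.1 ≠ θ'.x.1 →
      Relation.ReflTransGen Nielsen.Admissible θ θ' := by
    intro θ θ' h
    obtain ⟨k, hk1, hk2⟩ := exists_third hr θ.x.1 θ'.x.1
    obtain ⟨η, hηx, hηy⟩ := exists_state θ.x (k, true) hk1.symm
    obtain ⟨ζ, hζx, hζy⟩ := exists_state θ'.x θ.x h.symm
    refine ((same θ η hηx.symm).tail (Or.inr ⟨hζy.trans hηx.symm, ?_⟩)).trans (same ζ θ' hζx)
    rw [hζx, hηy]
    exact hinv _ _ hk2.symm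
  by_cases h : θ.x.1 = θ'.x.1
  · obtain ⟨k, hk1, -⟩ := exists_third hr θ.x.1 θ.x.1
    obtain ⟨η, hηx, -⟩ := exists_state (k, true) θ.x hk1
    have e : η.x.1 = k := by rw [hηx]
    exact (diff θ η (by rw [e]; exact hk1.symm)).trans (diff η θ' (by rw [e, ← h]; exact hk1))
  · exact diff θ θ' h

lemma exists_word_fixing (hr : 3 ≤ r) (τ a : Nielsen r) :
    ∃ w : List (Selection r), endState a w = τ ∧ endState τ w = τ := by
  classical
  induction reflTransGen_admissible hr a τ using Relation.ReflTransGen.head_induction_on with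
  | refl => exact ⟨[], rfl, rfl⟩
  | @head a b hab _ ih =>
    obtain ⟨w, hw1, hw2⟩ := ih
    by_cases ha : a = τ
    · exact ⟨[], ha, rfl⟩
    · let u : Selection r := Function.update
        (fun θ => ⟨θ, θ.admissible_self⟩) a ⟨b, hab⟩
      have ua : (u a).1 = b := by simp [u]
      have uτ : (u τ).1 = τ := by simp [u, Function.update_of_ne (Ne.symm ha)]
      refine ⟨u :: w, ?_, ?_⟩
      · change endState (u a).1 w = τ
        rw [ua, hw1]
      · change endState (u τ).1 w = τ
        rw [uτ, hw2]

/-- A synchronizing word: it brings all states to `τ`. -/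
lemma exists_synchronizing_word (hr : 3 ≤ r) (τ : Nielsen r) :
    ∃ w : List (Selection r), ∀ s, endState s w = τ := by
  classical
  suffices h : ∀ A : Finset (Nielsen r), ∃ w : List (Selection r), ∀ s ∈ A, endState s w = τ by
    obtain ⟨w, hw⟩ := h Finset.univ
    exact ⟨w, fun s => hw s (Finset.mem_univ s)⟩
  intro A
  induction A using Finset.induction_on with
  | empty => exact ⟨[], by simp⟩
  | insert a A _ ih =>
    obtain ⟨v, hv⟩ := ih
    obtain ⟨w, hw1, hw2⟩ := exists_word_fixing hr τ (endState a v)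
    refine ⟨v ++ w, fun s hs => ?_⟩
    rw [endState_append]
    rcases Finset.mem_insert.1 hs with rfl | hs
    · exact hw1
    · rw [hv s hs, hw2]

/-- A word of selections is resetting if the state that it reaches does not depend on the initial
state, and if all states are visited on the way. The first property makes the future independent
of the past, and the second one gives a transition matrix without zero entries. -/
def Resetting (v : List (Selection r)) : Prop :=
  (∀ s s', endState s v = endState s' v) ∧ ∀ s θ, θ ∈ path s v

lemma Resetting.append_left {v : List (Selection r)} (h : Resetting v) (w : List (Selection r)) :
    Resetting (w ++ v) := by
  refine ⟨fun s s' => ?_, fun s θ => ?_⟩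
  · rw [endState_append, endState_append]
    exact h.1 _ _
  · rw [path_append]
    exact List.mem_append_right _ (h.2 _ θ)

lemma Resetting.append_right {v : List (Selection r)} (h : Resetting v) (w : List (Selection r)) :
    Resetting (v ++ w) := by
  refine ⟨fun s s' => ?_, fun s θ => ?_⟩
  · rw [endState_append, endState_append, h.1 s s']
  · rw [path_append]
    exact List.mem_append_left _ (h.2 _ θ)

lemma exists_resetting (hr : 3 ≤ r) : ∃ v : List (Selection r), Resetting v := by
  classical
  obtain ⟨τ, -, -⟩ := exists_state ((⟨0, by omega⟩, true) : Letter r) (⟨1, by omega⟩, true)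
    (by simp)
  suffices h : ∀ B : Finset (Nielsen r), ∃ v : List (Selection r),
      (∀ s s', endState s v = endState s' v) ∧ ∀ s, ∀ θ ∈ B, θ ∈ path s v by
    obtain ⟨v, hv, hv'⟩ := h Finset.univ
    exact ⟨v, hv, fun s θ => hv' s θ (Finset.mem_univ θ)⟩
  intro B
  induction B using Finset.induction_on with
  | empty =>
    obtain ⟨w, hw⟩ := exists_synchronizing_word hr τ
    exact ⟨w, fun s s' => (hw s).trans (hw s').symm, by simp⟩
  | insert a B _ ih =>
    obtain ⟨v, hv1, hv2⟩ := ih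
    obtain ⟨w, hw⟩ := exists_synchronizing_word hr a
    refine ⟨v ++ (w ++ [fun θ => ⟨θ, θ.admissible_self⟩]), fun s s' => ?_, fun s θ hθ => ?_⟩
    · simp only [endState_append, hv1 s s']
    · rw [path_append, path_append, hw]
      rcases Finset.mem_insert.1 hθ with rfl | hθ
      · simp [path]
      · exact List.mem_append_left _ (hv2 s θ hθ)

/-- Almost surely a fixed word occurs as a block with positive frequency. -/
lemma exists_frequency (G : List (Selection r)) : ∃ p : ℝ, 0 < p ∧
    ∀ᵐ U ∂drivingMeasure r, ∃ c : ℕ → ℝ, Tendsto (fun k : ℕ => c k / k) atTop (𝓝 p) ∧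
      ∀ k l, c k < c l → ∃ j, k ≤ j ∧ j < l ∧ block G.length U j = G := by
  classical
  set f : List (Selection r) → ℝ := fun v => if v = G then 1 else 0 with hf
  refine ⟨∫ U, f (block G.length U 0) ∂drivingMeasure r, ?_, ?_⟩
  · have hm : MeasurableSet {U : ℕ → Selection r | block G.length U 0 = G} := by
      have := measurable_block (r := r) G.length (fun v => if v = G then (1 : ℕ) else 0) 0
      have h2 := this (MeasurableSet.singleton 1)
      convert h2 using 1
      ext U
      simp
    have e : (fun U => f (block G.length U 0)) =
        {U : ℕ → Selection r | block G.length U 0 = G}.indicator 1 := by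
      funext U
      simp [hf, Set.indicator_apply]
    rw [e, integral_indicator_one hm]
    exact ENNReal.toReal_pos (block_zero_eq_pos G).ne' (measure_ne_top _ _)
  · filter_upwards [block_law_of_large_numbers (r := r) G.length f] with U hU
    refine ⟨_, hU, fun k l hkl => ?_⟩
    by_contra hne
    push Not at hne
    refine absurd hkl (not_lt.2 ?_)
    rcases le_total l k with h | h
    · exact Finset.sum_le_sum_of_subset_of_nonneg (Finset.range_mono h) fun j _ _ => by
        simp only [hf]; split_ifs <;> norm_num
    · rw [← Finset.sum_range_add_sum_Ico _ h]
      have : ∑ j ∈ Finset.Ico k l, f (block G.length U j) = 0 :=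
        Finset.sum_eq_zero fun j hj => by
          rw [Finset.mem_Ico] at hj
          simp [hf, hne j hj.1 hj.2]
      rw [this, add_zero]

/-- The probability that the first `q` selections do not form a resetting word. -/
noncomputable def failure (r q : ℕ) : ℝ :=
  (drivingMeasure r).real {U | ¬ Resetting ((List.range q).map U)}

lemma measurable_map_range {β : Type*} [MeasurableSpace β] (f : List (Selection r) → β) (q : ℕ) :
    Measurable fun U : ℕ → Selection r => f ((List.range q).map U) := by
  have h := measurable_block (r := r) q f 0
  have e : ∀ U : ℕ → Selection r, block q U 0 = (List.range q).map U := by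
    intro U
    have := map_range_succ_mul q U 0
    simpa using this.symm
  simpa only [e] using h

lemma measurableSet_not_resetting (q : ℕ) :
    MeasurableSet {U : ℕ → Selection r | ¬ Resetting ((List.range q).map U)} := by
  have h : Measurable fun U : ℕ → Selection r => Resetting ((List.range q).map U) :=
    measurable_map_range (r := r) Resetting q
  exact (measurableSet_setOfPred.2 h).compl

lemma tendsto_failure (hr : 3 ≤ r) : Tendsto (failure r) atTop (𝓝 0) := by
  obtain ⟨G, hG⟩ := exists_resetting hr
  set s : ℕ → Set (ℕ → Selection r) := fun q => {U | ¬ Resetting ((List.range q).map U)} with hs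
  have hanti : Antitone s := by
    intro q q' hq U hU hres
    refine hU ?_
    obtain ⟨m, rfl⟩ := Nat.exists_eq_add_of_le hq
    rw [List.range_add, List.map_append]
    exact hres.append_right _
  have hlim := tendsto_measure_iInter_atTop (μ := drivingMeasure r) (s := s)
    (fun q => (measurableSet_not_resetting q).nullMeasurableSet) hanti ⟨0, measure_ne_top _ _⟩
  have hzero : drivingMeasure r (⋂ q, s q) = 0 := by
    obtain ⟨p, hp, hae⟩ := exists_frequency G
    refine measure_mono_null ?_ (ae_iff.1 hae)
    intro U hU
    simp only [Set.mem_ofPred_eq]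
    rintro ⟨c, hc, hcount⟩
    -- A positive frequency forces the count to exceed its value at `0`.
    have h1 : ∀ᶠ k : ℕ in atTop, c 0 < c k := by
      have h2 : Tendsto (fun k : ℕ => c k / k - c 0 / k) atTop (𝓝 (p - 0)) :=
        hc.sub (tendsto_const_div_atTop_nhds_zero_nat _)
      rw [sub_zero] at h2
      filter_upwards [h2.eventually (lt_mem_nhds hp), eventually_gt_atTop 0] with k hk hk0
      rw [← sub_div] at hk
      have := (div_pos_iff_of_pos_right (Nat.cast_pos.2 hk0)).1 hk
      linarith
    obtain ⟨k, hk⟩ := h1.exists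
    obtain ⟨j, -, -, hj⟩ := hcount 0 k hk
    refine Set.mem_iInter.1 hU ((j + 1) * G.length) ?_
    rw [map_range_succ_mul, hj]
    exact hG.append_left _
  rw [hzero] at hlim
  exact (ENNReal.tendsto_toReal ENNReal.zero_ne_top).comp hlim

/-! ### Block bounds for the growth of the transition matrices -/

/-- `log` of the entry sum of `M(g_𝔱)`. -/
noncomputable def logSize (t : List (Nielsen r)) : ℝ := Real.log (entrySum (seqMatrix t))

lemma entrySum_seqMatrix_pos [NeZero r] (t : List (Nielsen r)) :
    (0 : ℝ) < entrySum (seqMatrix t) :=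
  Nat.cast_pos.2 ((Nat.pos_of_ne_zero (NeZero.ne r)).trans_le (le_entrySum_seqMatrix t))

lemma log_le_logSize [NeZero r] (t : List (Nielsen r)) : Real.log r ≤ logSize t :=
  Real.log_le_log (Nat.cast_pos.2 (Nat.pos_of_ne_zero (NeZero.ne r)))
    (Nat.cast_le.2 (le_entrySum_seqMatrix t))

lemma logSize_nonneg [NeZero r] (t : List (Nielsen r)) : 0 ≤ logSize t :=
  (Real.log_natCast_nonneg r).trans (log_le_logSize t)

lemma logSize_append_le [NeZero r] (t s : List (Nielsen r)) :
    logSize (t ++ s) ≤ logSize t + logSize s := by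
  rw [logSize, logSize, logSize, add_comm,
    ← Real.log_mul (entrySum_seqMatrix_pos _).ne' (entrySum_seqMatrix_pos _).ne']
  refine Real.log_le_log (entrySum_seqMatrix_pos _) ?_
  rw [seqMatrix_append]
  exact_mod_cast entrySum_mul_le _ _

lemma logSize_mono [NeZero r] (t s : List (Nielsen r)) : logSize t ≤ logSize (t ++ s) :=
  Real.log_le_log (entrySum_seqMatrix_pos _)
    (Nat.cast_le.2 (entrySum_seqMatrix_append_mono t s))

lemma logSize_le [NeZero r] (t : List (Nielsen r)) :
    logSize t ≤ (t.length + 1) * Real.log (r + 1) := by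
  have h : (entrySum (seqMatrix t) : ℝ) ≤ ((r : ℝ) + 1) ^ (t.length + 1) := by
    exact_mod_cast entrySum_seqMatrix_le t
  refine (Real.log_le_log (entrySum_seqMatrix_pos _) h).trans ?_
  rw [Real.log_pow]
  push_cast
  exact le_rfl

/-- If the middle part visits all states, `logSize` is superadditive on the outer parts. -/
lemma logSize_add_le [NeZero r] (t s t' : List (Nielsen r)) (h : ∀ θ, θ ∈ s) :
    logSize t + logSize t' ≤ logSize (t ++ (s ++ t')) := by
  rw [logSize, logSize, logSize, add_comm,
    ← Real.log_mul (entrySum_seqMatrix_pos _).ne' (entrySum_seqMatrix_pos _).ne']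
  refine Real.log_le_log (mul_pos (entrySum_seqMatrix_pos _) (entrySum_seqMatrix_pos _)) ?_
  rw [seqMatrix_append, seqMatrix_append]
  exact_mod_cast entrySum_mul_entrySum_le _ _ _ (seqMatrix_pos s h)

open Classical in
/-- The guaranteed gain of `logSize` over a block: if the first `q` selections of the block form a
resetting word, the contribution of the rest of the block, which does not depend on the state at
the beginning of the block, and otherwise `0`. The state `s₀` is arbitrary. -/
noncomputable def blockGain (s₀ : Nielsen r) (q : ℕ) (v : List (Selection r)) : ℝ :=
  if Resetting (v.take q) then logSize (path (endState s₀ (v.take q)) (v.drop q)) else 0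

open Classical in
/-- A bound for the difference between the largest possible gain over a block of length `L` and
the guaranteed one. -/
noncomputable def blockError (q L : ℕ) (v : List (Selection r)) : ℝ :=
  (q + 1) * Real.log (r + 1) + if Resetting (v.take q) then 0 else (L + 1) * Real.log (r + 1)

lemma blockGain_le [NeZero r] (s₀ s : Nielsen r) (q : ℕ) (v : List (Selection r))
    (t : List (Nielsen r)) : logSize t + blockGain s₀ q v ≤ logSize (t ++ path s v) := by
  unfold blockGain
  split_ifs with h
  · conv_rhs => rw [← List.take_append_drop q v, path_append, h.1 s s₀]
    exact logSize_add_le _ _ _ (h.2 s)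
  · rw [add_zero]
    exact logSize_mono _ _

lemma le_blockGain_add_blockError [NeZero r] (s₀ s : Nielsen r) (q : ℕ) (v : List (Selection r))
    (t : List (Nielsen r)) :
    logSize (t ++ path s v) ≤ logSize t + (blockGain s₀ q v + blockError q v.length v) := by
  refine (logSize_append_le _ _).trans (add_le_add le_rfl ?_)
  have hc : 0 ≤ Real.log (r + 1) := Real.log_nonneg (by simp)
  unfold blockGain blockError
  split_ifs with h
  · conv_lhs => rw [← List.take_append_drop q v, path_append, h.1 s s₀]
    refine (logSize_append_le _ _).trans ?_
    rw [add_zero, add_comm]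
    refine add_le_add le_rfl ((logSize_le _).trans ?_)
    refine mul_le_mul_of_nonneg_right ?_ hc
    rw [length_path, List.length_take]
    have : ((min q v.length : ℕ) : ℝ) ≤ q := Nat.cast_le.2 (min_le_left _ _)
    linarith
  · rw [zero_add]
    refine (logSize_le _).trans ?_
    rw [length_path]
    have : 0 ≤ ((q : ℝ) + 1) * Real.log (r + 1) := by positivity
    linarith

lemma sum_blockGain_le [NeZero r] (s₀ s : Nielsen r) (q L : ℕ) (U : ℕ → Selection r) (k : ℕ) :
    ∑ j ∈ Finset.range k, blockGain s₀ q (block L U j) ≤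
      logSize (initialSegment (walk s U) (k * L)) := by
  induction k with
  | zero =>
    rw [Finset.sum_range_zero]
    exact logSize_nonneg _
  | succ k ih =>
    rw [Finset.sum_range_succ, initialSegment_walk, map_range_succ_mul, path_append,
      ← initialSegment_walk]
    exact (add_le_add ih le_rfl).trans (blockGain_le _ _ _ _ _)

lemma le_sum_blockGain_add_blockError [NeZero r] (s₀ s : Nielsen r) (q L : ℕ)
    (U : ℕ → Selection r) (k : ℕ) :
    logSize (initialSegment (walk s U) (k * L)) ≤ logSize ([] : List (Nielsen r)) +
      ∑ j ∈ Finset.range k, (blockGain s₀ q (block L U j) + blockError q L (block L U j)) := by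
  induction k with
  | zero => simp [initialSegment]
  | succ k ih =>
    rw [Finset.sum_range_succ, initialSegment_walk, map_range_succ_mul, path_append,
      ← initialSegment_walk, ← add_assoc]
    have h := le_blockGain_add_blockError s₀ (endState s ((List.range (k * L)).map U)) q
      (block L U k) (initialSegment (walk s U) (k * L))
    rw [length_block] at h
    exact h.trans (add_le_add ih le_rfl)

lemma take_block_zero (q m : ℕ) (U : ℕ → Selection r) :
    (block (q + m) U 0).take q = (List.range q).map U := by
  refine List.ext_getElem (by simp [block]) fun i h1 h2 => ?_
  simp [block]

lemma integral_blockError (q m : ℕ) :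
    ∫ U, blockError q (q + m) (block (q + m) U 0) ∂drivingMeasure r =
      (q + 1) * Real.log (r + 1) + failure r q * (((q + m : ℕ) + 1) * Real.log (r + 1)) := by
  have e : (fun U : ℕ → Selection r => blockError q (q + m) (block (q + m) U 0)) =
      fun U => (q + 1) * Real.log (r + 1) +
        {U : ℕ → Selection r | ¬ Resetting ((List.range q).map U)}.indicator
          (fun _ => ((q + m : ℕ) + 1) * Real.log (r + 1)) U := by
    funext U
    unfold blockError
    rw [take_block_zero]
    by_cases h : Resetting ((List.range q).map U) <;> simp [h]
  rw [e, integral_add (integrable_const _)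
    ((integrable_const _).indicator (measurableSet_not_resetting q)), integral_const,
    integral_indicator_const _ (measurableSet_not_resetting q)]
  simp [failure]

lemma integral_blockGain_ge [NeZero r] (s₀ : Nielsen r) (q m : ℕ) :
    (1 - failure r q) * Real.log r ≤
      ∫ U, blockGain s₀ q (block (q + m) U 0) ∂drivingMeasure r := by
  have e : (1 - failure r q) * Real.log r = ∫ U, (Real.log r -
      {U : ℕ → Selection r | ¬ Resetting ((List.range q).map U)}.indicator
        (fun _ => Real.log r) U) ∂drivingMeasure r := by
    rw [integral_sub (integrable_const _)
      ((integrable_const _).indicator (measurableSet_not_resetting q)), integral_const,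
      integral_indicator_const _ (measurableSet_not_resetting q)]
    simp [failure]
    ring
  rw [e]
  refine integral_mono ((integrable_const _).sub
    ((integrable_const _).indicator (measurableSet_not_resetting q)))
    (integrable_block _ _ 0) fun U => ?_
  simp only [blockGain]
  rw [take_block_zero]
  by_cases h : Resetting ((List.range q).map U)
  · simp [h, log_le_logSize]
  · simp [h]

end TrainTrackWalk

namespace TrainTrackWalk

variable {r : ℕ}

/-! ### The Lyapunov exponent -/

lemma tendsto_natDiv_div {L : ℕ} (hL : 0 < L) :
    Tendsto (fun n : ℕ => ((n / L : ℕ) : ℝ) / n) atTop (𝓝 (1 / L)) := by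
  have h := (tendsto_nat_floor_mul_div_atTop (R := ℝ) (a := 1 / L) (by positivity)).comp
    tendsto_natCast_atTop_atTop
  refine h.congr fun n => ?_
  simp only [Function.comp_apply]
  rw [one_div_mul_eq_div, Nat.floor_div_eq_div]

/-- A nondecreasing sequence that is controlled along the multiples of `L` by two sequences with
linear growth is controlled at all times. -/
lemma eventually_div_mem {Z S T : ℕ → ℝ} {L : ℕ} (hL : 0 < L) {c α β : ℝ} (hZ : Monotone Z)
    (hS : ∀ k, S k ≤ Z (k * L)) (hT : ∀ k, Z (k * L) ≤ c + T k)
    (hα : Tendsto (fun k : ℕ => S k / k) atTop (𝓝 α))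
    (hβ : Tendsto (fun k : ℕ => T k / k) atTop (𝓝 β)) {ε : ℝ} (hε : 0 < ε) :
    ∀ᶠ n : ℕ in atTop, α / L - ε < Z n / n ∧ Z n / n < β / L + ε := by
  have hdiv : Tendsto (fun n : ℕ => n / L) atTop atTop := Nat.tendsto_div_const_atTop hL.ne'
  have h1 : Tendsto (fun n : ℕ => S (n / L) / (n / L : ℕ) * (((n / L : ℕ) : ℝ) / n)) atTop
      (𝓝 (α / L)) := by
    rw [div_eq_mul_one_div α]
    exact (hα.comp hdiv).mul (tendsto_natDiv_div hL)
  have h2 : Tendsto (fun n : ℕ => c / n + T (n / L + 1) / (n / L + 1 : ℕ) *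
      (((n / L : ℕ) : ℝ) / n + 1 / n)) atTop (𝓝 (β / L)) := by
    have h3 := (hβ.comp ((tendsto_add_atTop_nat 1).comp hdiv)).mul
      ((tendsto_natDiv_div hL).add tendsto_one_div_atTop_nhds_zero_nat)
    have h4 := (tendsto_const_div_atTop_nhds_zero_nat c).add h3
    rw [zero_add, add_zero, mul_one_div] at h4
    exact h4
  filter_upwards [h1.eventually (lt_mem_nhds (sub_lt_self _ hε)),
    h2.eventually (gt_mem_nhds (lt_add_of_pos_right _ hε)), eventually_ge_atTop L] with n g1 g2 hn
  have hn0 : (0 : ℝ) < n := Nat.cast_pos.2 (hL.trans_le hn)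
  have hk : 0 < n / L := Nat.div_pos hn hL
  have hk0 : ((n / L : ℕ) : ℝ) ≠ 0 := (Nat.cast_pos.2 hk).ne'
  constructor
  · refine g1.trans_le ?_
    rw [div_mul_div_cancel₀ hk0]
    exact div_le_div_of_nonneg_right ((hS _).trans (hZ (Nat.div_mul_le_self n L))) hn0.le
  · refine lt_of_le_of_lt ?_ g2
    have hlt : n ≤ (n / L + 1) * L := by
      rw [Nat.succ_mul, mul_comm]
      have h3 := Nat.div_add_mod n L
      have h4 := Nat.mod_lt n hL
      omega
    have e : c / n + T (n / L + 1) / (n / L + 1 : ℕ) * (((n / L : ℕ) : ℝ) / n + 1 / n) =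
        (c + T (n / L + 1)) / n := by
      have : ((n / L + 1 : ℕ) : ℝ) ≠ 0 := by positivity
      rw [← add_div, ← Nat.cast_add_one, div_mul_div_cancel₀ this, ← add_div]
    rw [e]
    exact div_le_div_of_nonneg_right ((hZ hlt).trans (hT _)) hn0.le

lemma logSize_initialSegment_mono [NeZero r] (ω : ℕ → Nielsen r) :
    Monotone fun n => logSize (initialSegment ω n) := by
  intro n n' h
  obtain ⟨m, rfl⟩ := Nat.exists_eq_add_of_le h
  simp only [initialSegment, List.range_add, List.map_append]
  exact logSize_mono _ _

/-- Existence, constancy and positivity of the top Lyapunov exponent, for the trajectories driven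
by random selections. -/
lemma exists_lyapunov_driving (hr : 3 ≤ r) : ∃ l : ℝ, 0 < l ∧
    ∀ᵐ U ∂drivingMeasure r, ∀ s,
      Tendsto (fun n : ℕ => logSize (initialSegment (walk s U) n) / n) atTop (𝓝 l) := by
  have : NeZero r := ⟨by omega⟩
  obtain ⟨s₀, -, -⟩ := exists_state ((⟨0, by omega⟩, true) : Letter r) (⟨1, by omega⟩, true)
    (by simp)
  set C := Real.log (r + 1) with hC
  have hC0 : 0 ≤ C := Real.log_nonneg (by simp)
  -- Blocks of length `q + q ^ 2`: the prefix of length `q` in which a reset is expected is both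
  -- long and negligible.
  set q : ℕ → ℕ := fun i => i + 1
  set L : ℕ → ℕ := fun i => q i + q i ^ 2
  have hL : ∀ i, 0 < L i := fun i => by positivity
  have hLr : ∀ i, (0 : ℝ) < L i := fun i => Nat.cast_pos.2 (hL i)
  set α : ℕ → ℝ := fun i => ∫ U, blockGain s₀ (q i) (block (L i) U 0) ∂drivingMeasure r
  set γ : ℕ → ℝ := fun i => ∫ U, blockError (q i) (L i) (block (L i) U 0) ∂drivingMeasure r
  have hγ : Tendsto (fun i => γ i / L i) atTop (𝓝 0) := by
    have hlim : Tendsto (fun i : ℕ => C * (1 / ((i : ℝ) + 1)) + failure r (q i) * (2 * C)) atTop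
        (𝓝 (C * 0 + 0 * (2 * C))) :=
      (tendsto_one_div_add_atTop_nhds_zero_nat.const_mul C).add
        (((tendsto_failure hr).comp (tendsto_add_atTop_nat 1)).mul_const _)
    rw [mul_zero, zero_mul, add_zero] at hlim
    have hf : ∀ i, 0 ≤ failure r (q i) := fun i => measureReal_nonneg
    have hγi : ∀ i, γ i = (q i + 1) * C + failure r (q i) * ((L i + 1) * C) :=
      fun i => integral_blockError (q i) (q i ^ 2)
    refine squeeze_zero (fun i => ?_) (fun i => ?_) hlim
    · rw [hγi]
      have := hf i
      positivity
    · have hL1 : (1 : ℝ) ≤ L i := Nat.one_le_cast.2 (hL i)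
      have hLq : (L i : ℝ) = ((i : ℝ) + 1) * (q i + 1) := by
        simp only [L, q]
        push_cast
        ring
      rw [hγi, add_div]
      refine add_le_add (le_of_eq ?_) ?_
      · rw [hLq]
        have : ((q i : ℝ) + 1) ≠ 0 := by positivity
        field_simp
      · rw [div_le_iff₀ (hLr i), mul_assoc]
        refine mul_le_mul_of_nonneg_left ?_ (hf i)
        nlinarith
  have hae : ∀ᵐ U ∂drivingMeasure r, ∀ i s, ∀ ε : ℝ, 0 < ε → ∀ᶠ n : ℕ in atTop,
      α i / L i - ε < logSize (initialSegment (walk s U) n) / n ∧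
      logSize (initialSegment (walk s U) n) / n < (α i + γ i) / L i + ε := by
    rw [ae_all_iff]
    intro i
    have e : ∫ U, (blockGain s₀ (q i) (block (L i) U 0) + blockError (q i) (L i) (block (L i) U 0))
        ∂drivingMeasure r = α i + γ i :=
      integral_add (integrable_block (L i) (blockGain s₀ (q i)) 0)
        (integrable_block (L i) (blockError (q i) (L i)) 0)
    have h2 := block_law_of_large_numbers (r := r) (L i)
      (fun v => blockGain s₀ (q i) v + blockError (q i) (L i) v)
    rw [e] at h2
    filter_upwards [block_law_of_large_numbers (r := r) (L i) (blockGain s₀ (q i)), h2] with U h1 h2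
    intro s ε hε
    exact eventually_div_mem (hL i) (logSize_initialSegment_mono _)
      (sum_blockGain_le s₀ s (q i) (L i) U) (le_sum_blockGain_add_blockError s₀ s (q i) (L i) U)
      h1 h2 hε
  -- One common sample point compares the bounds that come from different block lengths.
  have hab : ∀ i j, α i / L i ≤ (α j + γ j) / L j := by
    obtain ⟨U, hU⟩ := hae.exists
    intro i j
    by_contra hlt
    push Not at hlt
    obtain ⟨n, h1, h2⟩ := ((hU i s₀ _ (half_pos (sub_pos.2 hlt))).and
      (hU j s₀ _ (half_pos (sub_pos.2 hlt)))).exists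
    linarith [h1.1, h2.2]
  have hbdd : BddAbove (Set.range fun i => α i / L i) := ⟨_, by
    rintro _ ⟨i, rfl⟩
    exact hab i 0⟩
  refine ⟨⨆ i, α i / L i, ?_, ?_⟩
  · have h1 : ∀ᶠ i : ℕ in atTop, failure r (q i) < 1 :=
      ((tendsto_failure hr).comp (tendsto_add_atTop_nat 1)).eventually (gt_mem_nhds one_pos)
    obtain ⟨i, hi⟩ := h1.exists
    refine lt_of_lt_of_le ?_ (le_ciSup hbdd i)
    refine div_pos (lt_of_lt_of_le ?_ (integral_blockGain_ge s₀ (q i) (q i ^ 2))) (hLr i)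
    have : (1 : ℝ) < r := by
      have : 1 < r := by omega
      exact_mod_cast this
    exact mul_pos (sub_pos.2 hi) (Real.log_pos this)
  · filter_upwards [hae] with U hU s
    rw [Metric.tendsto_atTop']
    intro ε hε
    obtain ⟨i, hi⟩ := (hγ.eventually (gt_mem_nhds (half_pos hε))).exists
    have h1 := le_ciSup hbdd i
    have h2 : ⨆ j, α j / L j ≤ (α i + γ i) / L i := ciSup_le fun j => hab j i
    obtain ⟨N, hN⟩ := eventually_atTop.1 (hU i s (ε / 2) (half_pos hε))
    refine ⟨N, fun n hn => ?_⟩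
    obtain ⟨g1, g2⟩ := hN n hn.le
    rw [add_div] at g2 h2
    rw [Real.dist_eq, abs_lt]
    constructor <;> linarith

/-- Almost surely, a resetting word occurs in the second half of every long trajectory, so that
some diagonal entry of `M(g_{𝔱_n})` dominates, up to the factor `r`, the entry sum of
`M(g_{𝔱_{kN}})` for all large `k` with `2kN ≤ n`. -/
lemma exists_diag_bound (hr : 3 ≤ r) : ∃ N : ℕ, 0 < N ∧ ∀ᵐ ω ∂walkMeasure r,
    ∀ᶠ k : ℕ in atTop, ∀ n : ℕ, 2 * k * N ≤ n → ∃ i,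
      entrySum (seqMatrix (initialSegment ω (k * N))) ≤ r * seqMatrix (initialSegment ω n) i i := by
  have : NeZero r := ⟨by omega⟩
  obtain ⟨G, hG⟩ := exists_resetting hr
  obtain ⟨s₀, -, -⟩ := exists_state ((⟨0, by omega⟩, true) : Letter r) (⟨1, by omega⟩, true)
    (by simp)
  have hG0 : 0 < G.length := by
    rw [List.length_pos_iff]
    rintro rfl
    exact List.not_mem_nil (hG.2 s₀ s₀)
  refine ⟨G.length, hG0, ae_walkMeasure hr ?_ fun s => ?_⟩
  · simp only [eventually_atTop]
    refine measurableSet_setOfPred.2 (Measurable.exists fun K => Measurable.forall fun k =>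
      Measurable.imp measurable_const (Measurable.forall fun n =>
      Measurable.imp measurable_const (Measurable.exists fun i => ?_)))
    exact measurableSet_setOfPred.1 (measurableSet_le
      (measurable_initialSegment (fun t => entrySum (seqMatrix t)) _)
      (measurable_initialSegment (fun t => r * seqMatrix t i i) _))
  · obtain ⟨p, hp, hae⟩ := exists_frequency G
    filter_upwards [hae] with U hU
    obtain ⟨c, hc, hcount⟩ := hU
    have h2 : Tendsto (fun k : ℕ => 2 * (c (2 * k) / (2 * k : ℕ)) - c k / k) atTop
        (𝓝 (2 * p - p)) :=
      ((hc.comp (tendsto_id.const_mul_atTop' two_pos)).const_mul 2).sub hc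
    have hpos : 0 < 2 * p - p := by linarith
    filter_upwards [h2.eventually (lt_mem_nhds hpos), eventually_gt_atTop 0] with k hk hk0 n hn
    have hlt : c k < c (2 * k) := by
      have hk0' : (0 : ℝ) < k := Nat.cast_pos.2 hk0
      have e : 2 * (c (2 * k) / (2 * k : ℕ)) - c k / k = (c (2 * k) - c k) / k := by
        push_cast
        field_simp
      rw [e] at hk
      linarith [(div_pos_iff_of_pos_right hk0').1 hk]
    obtain ⟨j, hj1, hj2, hj⟩ := hcount k (2 * k) hlt
    obtain ⟨m, rfl⟩ : ∃ m, n = (j + 1) * G.length + m := by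
      refine Nat.exists_eq_add_of_le (le_trans ?_ hn)
      exact Nat.mul_le_mul_right _ hj2
    obtain ⟨m', hm'⟩ : ∃ m', j * G.length = k * G.length + m' :=
      Nat.exists_eq_add_of_le (Nat.mul_le_mul_right _ hj1)
    have e1 : ∀ a b, initialSegment (walk s U) (a + b) = initialSegment (walk s U) a ++
        (List.range b).map (fun x => walk s U (a + x)) := by
      intro a b
      simp [initialSegment, List.range_add, Function.comp_def]
    have e2 : initialSegment (walk s U) ((j + 1) * G.length) =
        initialSegment (walk s U) (j * G.length) ++ path (walk s U (j * G.length)) G := by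
      rw [initialSegment_walk, map_range_succ_mul, path_append, endState_map_range,
        ← initialSegment_walk, hj]
    obtain ⟨i, hi⟩ := exists_entrySum_le_diag (initialSegment (walk s U) (j * G.length))
      (path (walk s U (j * G.length)) G)
      ((List.range m).map fun x => walk s U ((j + 1) * G.length + x)) (hG.2 _)
    refine ⟨i, ?_⟩
    rw [e1, e2]
    refine le_trans ?_ hi
    rw [hm', e1]
    exact entrySum_seqMatrix_append_mono _ _

lemma exists_lyapunov (hr : 3 ≤ r) : ∃ l : ℝ, 0 < l ∧ ∀ᵐ ω ∂walkMeasure r,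
    Tendsto (fun n : ℕ => logSize (initialSegment ω n) / n) atTop (𝓝 l) := by
  obtain ⟨l, hl, hae⟩ := exists_lyapunov_driving hr
  refine ⟨l, hl, ae_walkMeasure hr ?_ fun s => ?_⟩
  · exact measurableSet_tendsto _ fun n =>
      measurable_initialSegment (fun t => logSize t / n) n
  · filter_upwards [hae] with U hU using hU s

/-- The norm `‖M(g)‖` and the entry sum have the same exponential growth rate. -/
lemma tendsto_log_matrixNorm [NeZero r] {ω : ℕ → Nielsen r} {l : ℝ}
    (h : Tendsto (fun n : ℕ => logSize (initialSegment ω n) / n) atTop (𝓝 l)) :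
    Tendsto (fun n : ℕ => 1 / (n : ℝ) * Real.log (seqRoseMap (initialSegment ω n)).matrixNorm)
      atTop (𝓝 l) := by
  have hr : (0 : ℝ) < r := Nat.cast_pos.2 (Nat.pos_of_ne_zero (NeZero.ne r))
  have h1 := h.sub (tendsto_const_div_atTop_nhds_zero_nat (Real.log (r ^ 2)))
  rw [sub_zero] at h1
  refine tendsto_of_tendsto_of_tendsto_of_le_of_le h1 h (fun n => ?_) (fun n => ?_)
  all_goals
    have hlow := RoseMap.entrySum_le_matrixNorm (seqRoseMap (initialSegment ω n))
    have hup := RoseMap.matrixNorm_le_entrySum (seqRoseMap (initialSegment ω n))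
    have hpos : (0 : ℝ) < entrySum (seqRoseMap (initialSegment ω n)).transitionMatrix :=
      entrySum_seqMatrix_pos _
    have hnorm : 0 < (seqRoseMap (initialSegment ω n)).matrixNorm :=
      (mul_pos_iff_of_pos_left (by positivity)).1 (hpos.trans_le hlow)
  · have h2 := Real.log_le_log hpos hlow
    rw [Real.log_mul (by positivity) hnorm.ne'] at h2
    simp only
    rw [one_div_mul_eq_div, ← sub_div]
    refine div_le_div_of_nonneg_right ?_ (Nat.cast_nonneg n)
    rw [logSize, seqMatrix]
    linarith
  · rw [one_div_mul_eq_div]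
    exact div_le_div_of_nonneg_right (Real.log_le_log hnorm hup) (Nat.cast_nonneg n)

/-- Exponential growth rates of a sequence between two real sequences. -/
lemma growth_bounds {m : ℕ → ℕ} (hm : Tendsto m atTop atTop) {x : ℕ → ℝ≥0∞} {A B : ℕ → ℝ}
    {a b : ℝ} (hA0 : ∀ n, 0 < A n) (hB0 : ∀ n, 0 < B n)
    (hA : Tendsto (fun n : ℕ => Real.log (A n) / n) atTop (𝓝 a))
    (hB : Tendsto (fun n : ℕ => Real.log (B n) / n) atTop (𝓝 b))
    (hAx : ∀ᶠ i in atTop, ENNReal.ofReal (A (m i)) ≤ x i)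
    (hxB : ∀ᶠ i in atTop, x i ≤ ENNReal.ofReal (B (m i))) :
    (a : EReal) ≤ liminf (fun i : ℕ => ENNReal.log (x i) / (m i : EReal)) atTop ∧
      liminf (fun i : ℕ => ENNReal.log (x i) / (m i : EReal)) atTop ≤
        limsup (fun i : ℕ => ENNReal.log (x i) / (m i : EReal)) atTop ∧
      limsup (fun i : ℕ => ENNReal.log (x i) / (m i : EReal)) atTop ≤ (b : EReal) := by
  have key : ∀ {D : ℕ → ℝ} {d : ℝ}, (∀ n, 0 < D n) →
      Tendsto (fun n : ℕ => Real.log (D n) / n) atTop (𝓝 d) →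
      Tendsto (fun i => ENNReal.log (ENNReal.ofReal (D (m i))) / (m i : EReal)) atTop
        (𝓝 (d : EReal)) := by
    intro D d hD0 hD
    refine ((continuous_coe_real_ereal.tendsto d).comp (hD.comp hm)).congr fun i => ?_
    simp only [Function.comp_apply]
    rw [ENNReal.log_ofReal_of_pos (hD0 _), EReal.coe_div]
    rfl
  have hnn : ∀ i, (0 : EReal) ≤ (m i : EReal) := fun i => by positivity
  refine ⟨?_, liminf_le_limsup, ?_⟩
  · rw [← (key hA0 hA).liminf_eq]
    refine liminf_le_liminf ?_
    filter_upwards [hAx] with i hi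
    exact EReal.div_le_div_right_of_nonneg (hnn i) (ENNReal.log_le_log hi)
  · rw [← (key hB0 hB).limsup_eq]
    refine limsup_le_limsup ?_
    filter_upwards [hxB] with i hi
    exact EReal.div_le_div_right_of_nonneg (hnn i) (ENNReal.log_le_log hi)

end TrainTrackWalk

theorem theorem4p12 (r : ℕ) (hr : 3 ≤ r) :
    ∃ ℓ₁ : ℝ,
      (∀ᵐ ω ∂walkMeasure r,
        Tendsto (fun n : ℕ =>
            1 / (n : ℝ) * Real.log (seqRoseMap (initialSegment ω n)).matrixNorm)
          atTop (𝓝 ℓ₁)) ∧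
      0 < ℓ₁ ∧
      ∀ᵐ ω ∂walkMeasure r,
        (((ℓ₁ / 2 : ℝ) : EReal) ≤
            liminf (fun n : ℕ =>
              ENNReal.log (seqRoseMap (initialSegment ω n)).specRadius / (n : EReal)) atTop ∧
          liminf (fun n : ℕ =>
              ENNReal.log (seqRoseMap (initialSegment ω n)).specRadius / (n : EReal)) atTop ≤
            limsup (fun n : ℕ =>
              ENNReal.log (seqRoseMap (initialSegment ω n)).specRadius / (n : EReal)) atTop ∧
          limsup (fun n : ℕ =>
              ENNReal.log (seqRoseMap (initialSegment ω n)).specRadius / (n : EReal)) atTop ≤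
            (ℓ₁ : EReal)) ∧
        ∀ m : ℕ → ℕ, StrictMono m →
          (∀ i, CyclicallyAdmissible (initialSegment ω (m i))) →
          ((ℓ₁ / 2 : ℝ) : EReal) ≤
              liminf (fun i : ℕ =>
                ENNReal.log (stretch (seqOut (initialSegment ω (m i)))) / (m i : EReal)) atTop ∧
            liminf (fun i : ℕ =>
                ENNReal.log (stretch (seqOut (initialSegment ω (m i)))) / (m i : EReal)) atTop ≤
              limsup (fun i : ℕ =>
                ENNReal.log (stretch (seqOut (initialSegment ω (m i)))) / (m i : EReal)) atTop ∧
            limsup (fun i : ℕ =>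
                ENNReal.log (stretch (seqOut (initialSegment ω (m i)))) / (m i : EReal)) atTop ≤
              (ℓ₁ : EReal) := by
  have : NeZero r := ⟨by omega⟩
  have hr0 : (0 : ℝ) < r := Nat.cast_pos.2 (Nat.pos_of_ne_zero (NeZero.ne r))
  obtain ⟨l, hl, hlim⟩ := exists_lyapunov hr
  obtain ⟨N, hN, hdiag⟩ := exists_diag_bound hr
  refine ⟨l, ?_, hl, ?_⟩
  · filter_upwards [hlim] with ω hω using tendsto_log_matrixNorm hω
  · filter_upwards [hlim, hdiag] with ω hω hd
    -- `k n * N` is the largest multiple of `N` such that `2 * (k n * N) ≤ n`.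
    set k : ℕ → ℕ := fun n => n / (2 * N)
    set A : ℕ → ℝ := fun n => entrySum (seqMatrix (initialSegment ω (k n * N))) / r
    set B : ℕ → ℝ := fun n => entrySum (seqMatrix (initialSegment ω n))
    have hA0 : ∀ n, 0 < A n := fun n => div_pos (entrySum_seqMatrix_pos _) hr0
    have hB0 : ∀ n, 0 < B n := fun n => entrySum_seqMatrix_pos _
    have hk : Tendsto k atTop atTop := Nat.tendsto_div_const_atTop (by positivity)
    have hA : Tendsto (fun n : ℕ => Real.log (A n) / n) atTop (𝓝 (l / 2)) := by
      have h1 : Tendsto (fun n => logSize (initialSegment ω (k n * N)) / (k n * N : ℕ)) atTop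
          (𝓝 l) := hω.comp (hk.atTop_mul_const' hN)
      have h2 := (h1.mul ((tendsto_natDiv_div (L := 2 * N) (by positivity)).mul_const (N : ℝ))).sub
        (tendsto_const_div_atTop_nhds_zero_nat (Real.log r))
      have e : l * (1 / ((2 * N : ℕ) : ℝ) * N) - 0 = l / 2 := by
        have : (N : ℝ) ≠ 0 := (Nat.cast_pos.2 hN).ne'
        push_cast
        field_simp
        ring
      rw [e] at h2
      refine h2.congr' ?_
      filter_upwards [hk.eventually (eventually_gt_atTop 0)] with n hn
      have hkn : ((k n * N : ℕ) : ℝ) ≠ 0 := by positivity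
      have hlog : Real.log (A n) = logSize (initialSegment ω (k n * N)) - Real.log r :=
        Real.log_div (entrySum_seqMatrix_pos _).ne' hr0.ne'
      rw [hlog, sub_div, div_mul_eq_mul_div ((n / (2 * N) : ℕ) : ℝ), ← Nat.cast_mul,
        div_mul_div_cancel₀ hkn]
    have hdiagA : ∀ᶠ n in atTop, ∃ i,
        ENNReal.ofReal (A n) ≤ (seqMatrix (initialSegment ω n) i i : ℝ≥0∞) := by
      filter_upwards [hk.eventually hd] with n hn
      obtain ⟨i, hi⟩ := hn n (by
        rw [mul_right_comm, mul_comm]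
        exact Nat.div_mul_le_self _ _)
      refine ⟨i, ?_⟩
      rw [← ENNReal.ofReal_natCast]
      refine ENNReal.ofReal_le_ofReal ((div_le_iff₀' hr0).2 ?_)
      exact_mod_cast hi
    have hcastB : ∀ n, ENNReal.ofReal (B n) =
        (entrySum (seqMatrix (initialSegment ω n)) : ℕ) := fun n => ENNReal.ofReal_natCast _
    refine ⟨growth_bounds tendsto_id hA0 hB0 hA hω ?_ ?_, fun m hm hadm =>
      growth_bounds hm.tendsto_atTop hA0 hB0 hA hω ?_ ?_⟩
    · filter_upwards [hdiagA] with n hn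
      obtain ⟨i, hi⟩ := hn
      exact hi.trans (RoseMap.diag_le_specRadius _ i)
    · refine Eventually.of_forall fun n => ?_
      rw [hcastB]
      exact RoseMap.specRadius_le_entrySum _
    · filter_upwards [hm.tendsto_atTop.eventually hdiagA] with j hj
      obtain ⟨i, hi⟩ := hj
      exact hi.trans (diag_le_stretch (hadm j) i)
    · refine Eventually.of_forall fun j => ?_
      rw [hcastB]
      exact (seqRoseMap_represents _).stretch_le
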